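/- **Setting.** Let $\mathcal H$ and $\mathfrak h$ be complex Hilbert spaces (scalar products conjugate-linear in the first variable), $A:D(A)\subseteq\mathcal H\to\mathcal H$ a self-adjoint operator, and $\mathcal H_+$ the Hilbert space $D(A)$ with the graph scalar product $\langle\phi_1,\phi_2\rangle_+=\langle\phi_1,\phi_2\rangle+\langle A\phi_1,A\phi_2\rangle$. Let $\mathcal H_-$ be the completion of $\mathcal H$ with respect to the norm $\|(A^2+1)^{-1/2}\phi\|$, identified with the space of bounded conjugate-linear functionals on $\mathcal H_+$ by means of the pairing of $\mathcal H_+$ and $\mathcal H_-$ that extends the scalar product of $\mathcal H$; let $I_-:\mathcal H\to\mathcal H_-$ be the canonical embedding. Let $\tau:\mathcal H_+\to\mathfrak h$ be bounded, linear and surjective, with $\mathcal N:=\operatorname{Kernel}\tau$ dense in $\mathcal H$, and let $A_{\mathcal N}$ be the restriction of $A$ to $\mathcal N$. For $z$ in the resolvent set of $A$ put $$R(z)=(-A+z)^{-1},\qquad \breve G(z)=\tau R(z),\qquad G(z)=\breve G(\bar z)^*,$$ and $$G_\pm=G(\pm i),\qquad G_*=\tfrac12(G_++G_-),\qquad G_\diamond=\tfrac12(G_+-G_-),\qquad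 \Gamma=\tau(G_*-G_+)\in\mathsf B(\mathfrak h)$$ (the range of $G_*-G_+$ is contained in $D(A)$). Let $\bar A:\mathcal H\to\mathcal H_-$ be the unique bounded extension of $I_-A$, and let $\tau^*:\mathfrak h\to\mathcal H_-$ be the adjoint of $\tau$ with respect to the pairing, i.e. $\tau^*Q$ is the functional $\psi\mapsto\langle\tau\psi,Q\rangle_{\mathfrak h}$ on $\mathcal H_+$. Every element of $$D(\widetilde A):=\{\phi_*+G_*Q\,:\,\phi_*\in D(A),\ Q\in\mathfrak h\}$$ has a unique decomposition $\phi=\phi_*+G_*Q_\phi$; put $\widetilde A\phi:=\bar A\phi+T\phi\in\mathcal H_-$ with $T\phi:=\tau^*Q_\phi$. For a self-adjoint operator $\Theta:D(\Theta)\subseteq\mathfrak h\to\mathfrak h$ put $$D(A_\Theta):=\{\phi\in D(\widetilde A)\,:\,Q_\phi\in D(\Theta),\ \tau\phi_*=\Theta Q_\phi\},\qquad A_\Theta\phi:=A\phi_*+i\,G_\diamond Q_\phi.$$ Let $\mathcal K_\pm=\operatorname{Kernel}(-A_{\mathcal N}^*\pm i)$. For a unitary map $U:\mathcal K_+\to\mathcal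 K_-$ let the von Neumann extension $A_U$ be the restriction of $A_{\mathcal N}^*$ to $\mathcal N\oplus\operatorname{Graph}U=\{\phi_0+\phi_++U\phi_+\,:\,\phi_0\in\mathcal N,\ \phi_+\in\mathcal K_+\}$. **Theorem 4.1.** 1. $\widetilde A=A_{\mathcal N}^*$: the two operators have the same domain, and $\widetilde A\phi=I_-A_{\mathcal N}^*\phi$ for every $\phi$ in it. 2. $G_+$ and $G_-$ are continuous bijections from $\mathfrak h$ onto $\mathcal K_+$ and $\mathcal K_-$ respectively. The operator $-i\Gamma$ is non-negative, and $G_\pm$ are unitary when $\mathfrak h$ is given the scalar product $\langle Q_1,Q_2\rangle_\Gamma:=\langle\sqrt{-i\Gamma}\,Q_1,\sqrt{-i\Gamma}\,Q_2\rangle_{\mathfrak h}$, i.e. $\langle G_\pm Q_1,G_\pm Q_2\rangle=\langle Q_1,Q_2\rangle_\Gamma$ for all $Q_1,Q_2\in\mathfrak h$. 3. For every self-adjoint operator $\Theta$ in $\mathfrak h$, the operator $\Theta-\Gamma$ has an everywhere defined bounded inverse, the linear operator $$U:=-\,G_-\bigl(\mathsf 1+2(\Theta-\Gamma)^{-1}\Gamma\bigr)G_+^{-1}$$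 is unitary from $\mathcal K_+$ onto $\mathcal K_-$, the operator $A_\Theta$ is self-adjoint, and $A_U=A_\Theta$; moreover $I_-A_U\phi=\bar A\phi+T\phi$ for all $\phi\in D(A_U)=D(A_\Theta)$. -/

import Mathlib

open scoped InnerProductSpace ComplexConjugate

noncomputable section

namespace SingularExt

section Scales

variable {H : Type*} [NormedAddCommGroup H] [InnerProductSpace ℂ H]
variable {E : Type*} [NormedAddCommGroup E] [InnerProductSpace ℂ E]

/-- `H₊`: the domain of the operator `A`, to be equipped with the graph inner product
`⟨φ₁, φ₂⟩₊ = ⟨φ₁, φ₂⟩ + ⟨A φ₁, A φ₂⟩` (for a self-adjoint `A` this is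
`⟨(A² + 1)^{1/2} φ₁, (A² + 1)^{1/2} φ₂⟩`). -/
def HPlus (A : H →ₗ.[ℂ] H) : Type _ := A.domain

instance (A : H →ₗ.[ℂ] H) : AddCommGroup (HPlus A) := inferInstanceAs (AddCommGroup A.domain)

instance (A : H →ₗ.[ℂ] H) : Module ℂ (HPlus A) := inferInstanceAs (Module ℂ A.domain)

/-- The inclusion of `H₊` into `H`, as a linear map. -/
def inclLin (A : H →ₗ.[ℂ] H) : HPlus A →ₗ[ℂ] H := A.domain.subtype

/-- The operator `A` on `H₊`, as a linear map. -/
def opLin (A : H →ₗ.[ℂ] H) : HPlus A →ₗ[ℂ] H := A.toFun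

lemma inclLin_injective (A : H →ₗ.[ℂ] H) : Function.Injective (inclLin A) :=
  Subtype.val_injective

/-- The graph inner product on the domain of `A`. -/
@[reducible]
def hPlusCore (A : H →ₗ.[ℂ] H) : InnerProductSpace.Core ℂ (HPlus A) where
  inner x y := ⟪inclLin A x, inclLin A y⟫_ℂ + ⟪opLin A x, opLin A y⟫_ℂ
  conj_inner_symm x y := by simp [inner_conj_symm]
  re_inner_nonneg x := by
    have h1 := inner_self_nonneg (𝕜 := ℂ) (x := inclLin A x)
    have h2 := inner_self_nonneg (𝕜 := ℂ) (x := opLin A x)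
    simpa using add_nonneg h1 h2
  add_left x y z := by simp; ring
  smul_left x y r := by simp; ring
  definite x hx := by
    have h1 := inner_self_nonneg (𝕜 := ℂ) (x := inclLin A x)
    have h2 := inner_self_nonneg (𝕜 := ℂ) (x := opLin A x)
    have h3 := congrArg RCLike.re hx
    simp only [map_add, map_zero] at h3
    have h4 : RCLike.re ⟪inclLin A x, inclLin A x⟫_ℂ = 0 := by linarith
    rw [inner_self_eq_norm_sq] at h4
    have h5 : inclLin A x = 0 := by simpa using h4
    exact inclLin_injective A (by simpa using h5)

instance (A : H →ₗ.[ℂ] H) : NormedAddCommGroup (HPlus A) :=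
  (hPlusCore A).toNormedAddCommGroup

instance (A : H →ₗ.[ℂ] H) : InnerProductSpace ℂ (HPlus A) :=
  InnerProductSpace.ofCore (hPlusCore A).toCore

lemma hPlus_inner (A : H →ₗ.[ℂ] H) (x y : HPlus A) :
    ⟪x, y⟫_ℂ = ⟪inclLin A x, inclLin A y⟫_ℂ + ⟪opLin A x, opLin A y⟫_ℂ := rfl

lemma hPlus_norm_sq (A : H →ₗ.[ℂ] H) (x : HPlus A) :
    ‖x‖ ^ 2 = ‖inclLin A x‖ ^ 2 + ‖opLin A x‖ ^ 2 := by
  have h := hPlus_inner A x x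
  simp only [inner_self_eq_norm_sq_to_K] at h
  exact_mod_cast h

/-- The continuous inclusion `H₊ → H`. -/
def incl (A : H →ₗ.[ℂ] H) : HPlus A →L[ℂ] H :=
  (inclLin A).mkContinuous 1 fun x => by
    rw [one_mul]
    refine le_of_sq_le_sq ?_ (norm_nonneg _)
    rw [hPlus_norm_sq]; nlinarith [sq_nonneg ‖opLin A x‖]

/-- The operator `A` as an element of `B(H₊, H)`. -/
def op (A : H →ₗ.[ℂ] H) : HPlus A →L[ℂ] H :=
  (opLin A).mkContinuous 1 fun x => by
    rw [one_mul]
    refine le_of_sq_le_sq ?_ (norm_nonneg _)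
    rw [hPlus_norm_sq]; nlinarith [sq_nonneg ‖inclLin A x‖]

/-- `H₋`: the strong (conjugate-linear) dual of `H₊`. An element `φ` of `H₋` is the functional
`ψ ↦ ⟨ψ, φ⟩`, the extension to `H₊ × H₋` of the scalar product of `H`. See `norm_iMinus` and
`denseRange_iMinus`: together with the embedding `iMinus` it is the completion of `H` with respect
to the norm `‖(A² + 1)^{-1/2} φ‖`. -/
abbrev HMinus (A : H →ₗ.[ℂ] H) : Type _ := HPlus A →L⋆[ℂ] ℂ

/-- For `L ∈ B(H₊, E)`, the adjoint `L^* ∈ B(E, H₋)` with respect to the pairing of `H₊` and `H₋`: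
`L^* e` is the functional `ψ ↦ ⟨L ψ, e⟩`. -/
def pairingAdjoint {A : H →ₗ.[ℂ] H} (L : HPlus A →L[ℂ] E) : E →L[ℂ] HMinus A :=
  ((innerSL ℂ : E →L⋆[ℂ] E →L[ℂ] ℂ).comp L).flip

lemma pairingAdjoint_apply {A : H →ₗ.[ℂ] H} (L : HPlus A →L[ℂ] E) (e : E) (ψ : HPlus A) :
    pairingAdjoint L e ψ = ⟪L ψ, e⟫_ℂ := rfl

/-- The canonical embedding `I₋ : H → H₋`. -/
def iMinus (A : H →ₗ.[ℂ] H) : H →L[ℂ] HMinus A := pairingAdjoint (incl A)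

/-- The extension `Ā ∈ B(H, H₋)` of `A` to the whole of `H`; see `opBar_incl` and
`eq_opBar_of_extends`. -/
def opBar (A : H →ₗ.[ℂ] H) : H →L[ℂ] HMinus A := pairingAdjoint (op A)

/-- The resolvent set of a (closed) operator `A`. -/
def rho (A : H →ₗ.[ℂ] H) : Set ℂ := {z | (z • incl A - op A).IsInvertible}

/-- The resolvent `R(z) = (-A + z)⁻¹ ∈ B(H, H₊)`, for `z` in the resolvent set. -/
def res (A : H →ₗ.[ℂ] H) (z : ℂ) : H →L[ℂ] HPlus A := (z • incl A - op A).inverse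

lemma opBar_incl (A : H →ₗ.[ℂ] H) [CompleteSpace H] (hA : IsSelfAdjoint A) (ψ : HPlus A) :
    opBar A (incl A ψ) = iMinus A (op A ψ) := by
  ext χ
  change ⟪op A χ, incl A ψ⟫_ℂ = ⟪incl A χ, op A ψ⟫_ℂ
  have h := LinearPMap.adjoint_isFormalAdjoint hA.dense_domain
  rw [LinearPMap.isSelfAdjoint_def.mp hA] at h
  exact h χ ψ

lemma eq_opBar_of_extends (A : H →ₗ.[ℂ] H) [CompleteSpace H] (hA : IsSelfAdjoint A)
    (B : H →L[ℂ] HMinus A) (hB : ∀ ψ : HPlus A, B (incl A ψ) = iMinus A (op A ψ)) :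
    B = opBar A := by
  have hd : DenseRange (incl A) := by
    have h := hA.dense_domain
    rw [← Subtype.range_coe (s := (A.domain : Set H))] at h
    exact h
  have : (B : H → HMinus A) = opBar A :=
    hd.equalizer B.continuous (opBar A).continuous
      (funext fun ψ => by simp only [Function.comp]; rw [hB, opBar_incl A hA])
  exact DFunLike.coe_injective this

lemma hPlus_complete (A : H →ₗ.[ℂ] H) [CompleteSpace H] (hA : IsSelfAdjoint A) :
    CompleteSpace (HPlus A) := by
  have hcl : IsClosed (A.graph : Set (H × H)) := hA.isClosed
  let e : HPlus A →L[ℂ] H × H := (incl A).prod (op A)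
  have hanti : AntilipschitzWith 2 e := by
    refine AddMonoidHomClass.antilipschitz_of_bound e fun x => ?_
    have h := hPlus_norm_sq A x
    have h1 : ‖inclLin A x‖ ≤ ‖e x‖ := norm_fst_le (e x)
    have h2 : ‖opLin A x‖ ≤ ‖e x‖ := norm_snd_le (e x)
    refine le_of_sq_le_sq ?_ (by positivity)
    have := norm_nonneg (inclLin A x)
    have := norm_nonneg (opLin A x)
    push_cast
    nlinarith
  have hran : Set.range e = (A.graph : Set (H × H)) := by
    ext p
    constructor
    · rintro ⟨x, rfl⟩
      exact A.mem_graph x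
    · intro hp
      obtain ⟨x, h1, h2⟩ := (LinearPMap.mem_graph_iff A).mp hp
      exact ⟨x, Prod.ext h1 h2⟩
  rw [completeSpace_iff_isComplete_range (hanti.isUniformInducing e.uniformContinuous), hran]
  exact hcl.isComplete

lemma im_mul_norm_le (A : H →ₗ.[ℂ] H) [CompleteSpace H] (hA : IsSelfAdjoint A) (z : ℂ)
    (ψ : HPlus A) : |z.im| * ‖incl A ψ‖ ≤ ‖(z • incl A - op A) ψ‖ := by
  have hs := LinearPMap.adjoint_isFormalAdjoint hA.dense_domain
  rw [LinearPMap.isSelfAdjoint_def.mp hA] at hs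
  have hs' : ⟪op A ψ, incl A ψ⟫_ℂ = ⟪incl A ψ, op A ψ⟫_ℂ := hs ψ ψ
  have him : (⟪incl A ψ, op A ψ⟫_ℂ).im = 0 := by
    have h := inner_conj_symm (𝕜 := ℂ) (incl A ψ) (op A ψ)
    rw [hs'] at h
    exact Complex.conj_eq_iff_im.mp h
  have h1 : (⟪incl A ψ, (z • incl A - op A) ψ⟫_ℂ).im = z.im * ‖incl A ψ‖ ^ 2 := by
    simp only [sub_apply, smul_apply, inner_sub_right,
      inner_smul_right, Complex.sub_im, him, inner_self_eq_norm_sq_to_K]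
    simp [← Complex.ofReal_pow]
  have h2 : |z.im| * ‖incl A ψ‖ ^ 2 ≤ ‖incl A ψ‖ * ‖(z • incl A - op A) ψ‖ := by
    have h3 := (Complex.abs_im_le_norm _).trans
      (norm_inner_le_norm (𝕜 := ℂ) (incl A ψ) ((z • incl A - op A) ψ))
    rwa [h1, abs_mul, abs_of_nonneg (sq_nonneg ‖incl A ψ‖)] at h3
  rcases (norm_nonneg (incl A ψ)).eq_or_lt with h0 | h0
  · rw [← h0, mul_zero]; exact norm_nonneg _
  · nlinarith

/-- Nonreal numbers belong to the resolvent set of a self-adjoint operator. -/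
lemma mem_rho (A : H →ₗ.[ℂ] H) [CompleteSpace H] (hA : IsSelfAdjoint A) {z : ℂ}
    (hz : z.im ≠ 0) : z ∈ rho A := by
  have := hPlus_complete A hA
  set B : HPlus A →L[ℂ] H := z • incl A - op A with hB
  have hz' : 0 < |z.im| := abs_pos.mpr hz
  have hbound : ∀ ψ, ‖ψ‖ ≤ (1 + (1 + ‖z‖) / |z.im|) * ‖B ψ‖ := by
    intro ψ
    have h1 : ‖incl A ψ‖ ≤ ‖B ψ‖ / |z.im| := by
      rw [le_div_iff₀ hz', mul_comm]; exact im_mul_norm_le A hA z ψ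
    have h2 : ‖op A ψ‖ ≤ ‖z‖ * ‖incl A ψ‖ + ‖B ψ‖ := by
      have : op A ψ = z • incl A ψ - B ψ := by simp [hB]
      rw [this, ← norm_smul]
      exact norm_sub_le _ _
    have h3 : ‖ψ‖ ≤ ‖incl A ψ‖ + ‖op A ψ‖ := by
      refine le_of_sq_le_sq ?_ (by positivity)
      have h := hPlus_norm_sq A ψ
      change ‖ψ‖ ^ 2 = ‖incl A ψ‖ ^ 2 + ‖op A ψ‖ ^ 2 at h
      have := mul_nonneg (norm_nonneg (incl A ψ)) (norm_nonneg (op A ψ))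
      nlinarith
    calc ‖ψ‖ ≤ (1 + ‖z‖) * ‖incl A ψ‖ + ‖B ψ‖ := by linarith
      _ ≤ (1 + ‖z‖) * (‖B ψ‖ / |z.im|) + ‖B ψ‖ := by gcongr
      _ = _ := by ring
  have hinj : Function.Injective B := by
    rw [injective_iff_map_eq_zero]
    intro ψ h
    have := hbound ψ
    rw [h, norm_zero, mul_zero] at this
    exact norm_le_zero_iff.mp this
  have hanti : AntilipschitzWith (Real.toNNReal (1 + (1 + ‖z‖) / |z.im|)) B :=
    AddMonoidHomClass.antilipschitz_of_bound B fun x => by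
      rw [Real.coe_toNNReal _ (by positivity)]; exact hbound x
  have hclosed : IsClosed (Set.range B) := hanti.isClosed_range B.uniformContinuous
  have hortho : (B.range)ᗮ = ⊥ := by
    rw [Submodule.eq_bot_iff]
    intro y hy
    rw [Submodule.mem_orthogonal'] at hy
    have hy' : ∀ x : HPlus A, ⟪(starRingEnd ℂ z) • y, incl A x⟫_ℂ = ⟪y, op A x⟫_ℂ := by
      intro x
      have h := hy (B x) ⟨x, rfl⟩
      simp only [hB, sub_apply, smul_apply,
        inner_sub_right, inner_smul_right, sub_eq_zero] at h
      rw [inner_smul_left, Complex.conj_conj, h]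
    have hmem : y ∈ (LinearPMap.adjoint A).domain :=
      LinearPMap.mem_adjoint_domain_of_exists _ ⟨_, fun x => hy' x⟩
    have hval : (LinearPMap.adjoint A) ⟨y, hmem⟩ = (starRingEnd ℂ z) • y :=
      LinearPMap.adjoint_apply_eq hA.dense_domain _ fun x => hy' x
    have hgr : (y, (starRingEnd ℂ z) • y) ∈ A.graph := by
      rw [← LinearPMap.isSelfAdjoint_def.mp hA]
      rw [← hval]
      exact LinearPMap.mem_graph _ ⟨y, hmem⟩
    obtain ⟨x, h1, h2⟩ : ∃ x : HPlus A, incl A x = y ∧ op A x = (starRingEnd ℂ) z • y :=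
      (LinearPMap.mem_graph_iff A).mp hgr
    have h3 := im_mul_norm_le A hA (starRingEnd ℂ z) x
    simp only [sub_apply, smul_apply, h1, h2, sub_self, norm_zero, Complex.conj_im, abs_neg] at h3
    have : ‖y‖ ≤ 0 := by
      by_contra hc
      have := mul_pos hz' (not_le.mp hc)
      linarith
    exact norm_le_zero_iff.mp this
  have hsurj : Function.Surjective B := by
    have : CompleteSpace B.range := hclosed.completeSpace_coe
    have := (Submodule.orthogonal_eq_bot_iff (K := B.range)).mp hortho
    intro y
    have hy : y ∈ B.range := by rw [this]; trivial
    exact hy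
  refine ⟨ContinuousLinearEquiv.ofBijective B (LinearMap.ker_eq_bot.mpr hinj)
    (LinearMap.range_eq_top.mpr hsurj), ?_⟩
  ext; rfl

lemma res_right {A : H →ₗ.[ℂ] H} {z : ℂ} (hz : z ∈ rho A) (φ : H) :
    z • incl A (res A z φ) - op A (res A z φ) = φ := by
  exact ContinuousLinearMap.IsInvertible.self_apply_inverse hz φ

lemma res_left {A : H →ₗ.[ℂ] H} {z : ℂ} (hz : z ∈ rho A) (ψ : HPlus A) :
    res A z (z • incl A ψ - op A ψ) = ψ := by
  exact ContinuousLinearMap.IsInvertible.inverse_apply_self hz ψ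

lemma inner_op_comm (A : H →ₗ.[ℂ] H) [CompleteSpace H] (hA : IsSelfAdjoint A) (χ ψ : HPlus A) :
    ⟪op A χ, incl A ψ⟫_ℂ = ⟪incl A χ, op A ψ⟫_ℂ := by
  have h := LinearPMap.adjoint_isFormalAdjoint hA.dense_domain
  rw [LinearPMap.isSelfAdjoint_def.mp hA] at h
  exact h χ ψ

lemma norm_neg_I_sub (A : H →ₗ.[ℂ] H) [CompleteSpace H] (hA : IsSelfAdjoint A) (ψ : HPlus A) :
    ‖(-Complex.I) • incl A ψ - op A ψ‖ = ‖ψ‖ := by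
  refine (sq_eq_sq₀ (norm_nonneg _) (norm_nonneg _)).mp ?_
  rw [hPlus_norm_sq, @norm_sub_sq ℂ, inner_smul_left, ← inner_op_comm A hA]
  have him : (⟪op A ψ, incl A ψ⟫_ℂ).im = 0 := by
    have h := inner_conj_symm (𝕜 := ℂ) (incl A ψ) (op A ψ)
    rw [inner_op_comm A hA] at h ⊢
    exact Complex.conj_eq_iff_im.mp h
  simp [norm_smul, him]
  rfl

/-- The norm of `H₋` on `H` is `‖(-A + i)⁻¹ φ‖ = ‖(A² + 1)^{-1/2} φ‖`. -/
lemma norm_iMinus (A : H →ₗ.[ℂ] H) [CompleteSpace H] (hA : IsSelfAdjoint A) (φ : H) :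
    ‖iMinus A φ‖ = ‖incl A (res A Complex.I φ)‖ := by
  have hI : Complex.I ∈ rho A := mem_rho A hA (by simp)
  have hI' : -Complex.I ∈ rho A := mem_rho A hA (by simp)
  set χ := res A Complex.I φ with hχ
  have key : ∀ ψ : HPlus A,
      iMinus A φ ψ = ⟪(-Complex.I) • incl A ψ - op A ψ, incl A χ⟫_ℂ := by
    intro ψ
    change ⟪incl A ψ, φ⟫_ℂ = _
    rw [← res_right hI φ, ← hχ, inner_sub_right, inner_sub_left, inner_op_comm A hA,
      inner_smul_left, inner_smul_right]
    simp
  refine le_antisymm (ContinuousLinearMap.opNorm_le_bound _ (norm_nonneg _) fun ψ => ?_) ?_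
  · rw [key, ← norm_neg_I_sub A hA ψ, mul_comm]
    exact norm_inner_le_norm _ _
  · set ξ := res A (-Complex.I) (incl A χ) with hξ
    have h1 : (-Complex.I) • incl A ξ - op A ξ = incl A χ := res_right hI' _
    have h2 := (iMinus A φ).le_opNorm ξ
    rw [key, h1, ← norm_neg_I_sub A hA ξ, h1, inner_self_eq_norm_sq_to_K] at h2
    rcases (norm_nonneg (incl A χ)).eq_or_lt with h0 | h0
    · rw [← h0]; exact norm_nonneg (iMinus A φ)
    · simp only [norm_pow, RCLike.norm_ofReal, abs_norm] at h2
      nlinarith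

lemma denseRange_iMinus (A : H →ₗ.[ℂ] H) [CompleteSpace H] (hA : IsSelfAdjoint A) :
    DenseRange (iMinus A) := by
  have hI' : -Complex.I ∈ rho A := mem_rho A hA (by simp)
  let K : H →L[ℂ] HMinus A := pairingAdjoint ((-Complex.I) • incl A - op A)
  have hsurj : Function.Surjective K := by
    intro F
    let F' : H →L[ℂ] ℂ :=
      ((starL ℂ : ℂ ≃L⋆[ℂ] ℂ) : ℂ →L⋆[ℂ] ℂ).comp (F.comp (res A (-Complex.I)))
    refine ⟨(InnerProductSpace.toDual ℂ H).symm F', ?_⟩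
    ext ψ
    change ⟪(-Complex.I) • incl A ψ - op A ψ, (InnerProductSpace.toDual ℂ H).symm F'⟫_ℂ = F ψ
    rw [← inner_conj_symm, InnerProductSpace.toDual_symm_apply]
    change (starRingEnd ℂ) (star (F (res A (-Complex.I) _))) = _
    rw [res_left hI']
    simp
  have hd : DenseRange (incl A) := by
    have h := hA.dense_domain
    rw [← Subtype.range_coe (s := (A.domain : Set H))] at h
    exact h
  have hK : DenseRange (K ∘ incl A) := hsurj.denseRange.comp hd K.continuous
  refine hK.mono ?_
  rintro _ ⟨η, rfl⟩
  refine ⟨Complex.I • incl A η - op A η, ?_⟩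
  ext ψ
  change ⟪incl A ψ, Complex.I • incl A η - op A η⟫_ℂ
    = ⟪(-Complex.I) • incl A ψ - op A ψ, incl A η⟫_ℂ
  rw [inner_sub_right, inner_sub_left, inner_op_comm A hA, inner_smul_left, inner_smul_right]
  simp

end Scales

section VonNeumann

variable {H : Type*} [NormedAddCommGroup H] [InnerProductSpace ℂ H] [CompleteSpace H]

/-- `Kernel (-B^* + z)`; the deficiency spaces of `B` are those for `z = i` and `z = -i`. -/
def deficiency (B : H →ₗ.[ℂ] H) (z : ℂ) : Submodule ℂ H :=
  (LinearMap.ker (-B.adjoint.toFun + z • B.adjoint.domain.subtype)).map B.adjoint.domain.subtype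

lemma mem_deficiency_iff (B : H →ₗ.[ℂ] H) (z : ℂ) (φ : H) :
    φ ∈ deficiency B z ↔ ∃ h : φ ∈ B.adjoint.domain, B.adjoint ⟨φ, h⟩ = z • φ := by
  constructor
  · rintro ⟨φ, hφ, rfl⟩
    have h : -B.adjoint φ + z • (φ : H) = 0 := hφ
    exact ⟨φ.2, by rw [neg_add_eq_zero] at h; exact h⟩
  · rintro ⟨h, h'⟩
    refine ⟨⟨φ, h⟩, ?_, rfl⟩
    change -B.adjoint ⟨φ, h⟩ + z • φ = 0
    rw [h', neg_add_cancel]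

/-- The von Neumann extension of a closed symmetric operator `B` that corresponds to a unitary
map `U` between the deficiency spaces: the restriction of `B^*` to `D(B) ⊕ Graph U`, where
`Graph U = {φ + U φ}`. -/
def vonNeumann (B : H →ₗ.[ℂ] H)
    (U : deficiency B Complex.I ≃ₗᵢ[ℂ] deficiency B (-Complex.I)) : H →ₗ.[ℂ] H :=
  B.adjoint.domRestrict (B.domain ⊔ LinearMap.range ((deficiency B Complex.I).subtype +
    (deficiency B (-Complex.I)).subtype ∘ₗ U.toLinearEquiv.toLinearMap))

end VonNeumann

section Extensions

/-- The data: a self-adjoint operator `A` in `H` and a bounded surjective operator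
`τ : H₊ → 𝔥` whose kernel is dense in `H`. -/
structure ExtensionData (H 𝔥 : Type*) [NormedAddCommGroup H] [InnerProductSpace ℂ H]
    [CompleteSpace H] [NormedAddCommGroup 𝔥] [InnerProductSpace ℂ 𝔥] where
  /-- the self-adjoint operator -/
  A : H →ₗ.[ℂ] H
  isSelfAdjoint : IsSelfAdjoint A
  /-- the boundary map -/
  τ : HPlus A →L[ℂ] 𝔥
  surjective_τ : Function.Surjective τ
  dense_ker_τ : Dense {φ : H | ∃ ψ : HPlus A, τ ψ = 0 ∧ incl A ψ = φ}

namespace ExtensionData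

variable {H 𝔥 : Type*} [NormedAddCommGroup H] [InnerProductSpace ℂ H] [CompleteSpace H]
  [NormedAddCommGroup 𝔥] [InnerProductSpace ℂ 𝔥] (S : ExtensionData H 𝔥)

/-- `𝒩 = Kernel τ`, as a subspace of `H`. -/
def N : Submodule ℂ H := (LinearMap.ker S.τ.toLinearMap).map (incl S.A).toLinearMap

/-- The restriction `A_𝒩` of `A` to `𝒩`. -/
def AN : H →ₗ.[ℂ] H := S.A.domRestrict S.N

/-- `Ğ(z) = τ R(z)`. -/
def Gbreve (z : ℂ) : H →L[ℂ] 𝔥 := S.τ ∘L res S.A z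

/-- `τ^* ∈ B(𝔥, H₋)`. -/
def tauStar : 𝔥 →L[ℂ] HMinus S.A := pairingAdjoint S.τ

lemma mem_rho {z : ℂ} (hz : z.im ≠ 0) : z ∈ rho S.A := SingularExt.mem_rho S.A S.isSelfAdjoint hz

/-- If `τ^* Q` belongs to `H` then `Q = 0`. -/
lemma eq_zero_of_tauStar {Q : 𝔥} {χ : H} (h : S.tauStar Q = iMinus S.A χ) : Q = 0 := by
  have h1 : ∀ ψ : HPlus S.A, ⟪S.τ ψ, Q⟫_ℂ = ⟪incl S.A ψ, χ⟫_ℂ := fun ψ =>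
    congrArg (fun F : HMinus S.A => F ψ) h
  have hχ : χ = 0 := by
    have hd := S.dense_ker_τ
    refine hd.eq_zero_of_inner_right ℂ ?_
    rintro _ ⟨ψ, hψ, rfl⟩
    rw [← h1, hψ, inner_zero_left]
  obtain ⟨ψ, rfl⟩ := S.surjective_τ Q
  have h2 := h1 ψ
  rw [hχ, inner_zero_right] at h2
  exact inner_self_eq_zero.mp h2

variable [CompleteSpace 𝔥]

/-- `G(z) = Ğ(z̄)^*`. -/
def G (z : ℂ) : 𝔥 →L[ℂ] H := ContinuousLinearMap.adjoint (S.Gbreve (conj z))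

/-- `G_* = (G(z₀) + G(z̄₀)) / 2`. -/
def Gstar (z₀ : ℂ) : 𝔥 →L[ℂ] H := (1 / 2 : ℂ) • (S.G z₀ + S.G (conj z₀))

/-- `G_◇ = (G(z₀) - G(z̄₀)) / 2`. -/
def Gdiamond (z₀ : ℂ) : 𝔥 →L[ℂ] H := (1 / 2 : ℂ) • (S.G z₀ - S.G (conj z₀))

lemma inner_G (z : ℂ) (Q : 𝔥) (φ : H) : ⟪S.G z Q, φ⟫_ℂ = ⟪Q, S.τ (res S.A (conj z) φ)⟫_ℂ :=
  ContinuousLinearMap.adjoint_inner_left _ _ _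

lemma inner_G' (z : ℂ) (Q : 𝔥) (φ : H) : ⟪φ, S.G z Q⟫_ℂ = ⟪S.τ (res S.A (conj z) φ), Q⟫_ℂ :=
  ContinuousLinearMap.adjoint_inner_right _ _ _

/-- `Ā G(z) = z G(z) - τ^*`. -/
lemma opBar_G {z : ℂ} (hz : z.im ≠ 0) (Q : 𝔥) :
    opBar S.A (S.G z Q) = z • iMinus S.A (S.G z Q) - S.tauStar Q := by
  ext ψ
  change ⟪op S.A ψ, S.G z Q⟫_ℂ = z * ⟪incl S.A ψ, S.G z Q⟫_ℂ - ⟪S.τ ψ, Q⟫_ℂ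
  have h : S.τ (res S.A (conj z) ((conj z) • incl S.A ψ - op S.A ψ)) = S.τ ψ := by
    rw [res_left (S.mem_rho (by simpa using hz))]
  rw [← h, ← S.inner_G', inner_sub_left, inner_smul_left, Complex.conj_conj]
  ring

/-- The map `(φ_*, Q) ↦ φ_* + G_* Q`. -/
def decomp (z₀ : ℂ) : HPlus S.A × 𝔥 →ₗ[ℂ] H :=
  (incl S.A).toLinearMap ∘ₗ LinearMap.fst ℂ (HPlus S.A) 𝔥 +
    (S.Gstar z₀).toLinearMap ∘ₗ LinearMap.snd ℂ (HPlus S.A) 𝔥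

lemma decomp_apply (z₀ : ℂ) (p : HPlus S.A × 𝔥) :
    S.decomp z₀ p = incl S.A p.1 + S.Gstar z₀ p.2 := rfl

/-- The decomposition `φ = φ_* + G_* Q_φ` is unique. -/
lemma decomp_injective {z₀ : ℂ} (hz₀ : z₀.im ≠ 0) : Function.Injective (S.decomp z₀) := by
  rw [injective_iff_map_eq_zero]
  rintro ⟨φ, Q⟩ h
  rw [decomp_apply] at h
  have h0 := congrArg (opBar S.A) h
  have hbar : (conj z₀).im ≠ 0 := by simpa using hz₀
  simp only [Gstar, map_add, map_smul, smul_apply, add_apply, opBar_incl S.A S.isSelfAdjoint,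
    S.opBar_G hz₀, S.opBar_G hbar, map_zero] at h0
  have hQ : Q = 0 := by
    refine S.eq_zero_of_tauStar (χ := op S.A φ + (1 / 2 : ℂ) • (z₀ • S.G z₀ Q +
      (conj z₀) • S.G (conj z₀) Q)) ?_
    simp only [map_add, map_smul]
    rw [← sub_eq_zero, ← neg_eq_zero, ← h0]
    module
  subst hQ
  simp only [map_zero, add_zero] at h
  have : φ = 0 := inclLin_injective S.A (by rw [map_zero]; exact h)
  rw [this]; rfl

/-- `D(Ã) = {φ_* + G_* Q : φ_* ∈ D(A), Q ∈ 𝔥}`. -/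
def domTilde (z₀ : ℂ) : Submodule ℂ H := LinearMap.range (S.decomp z₀)

/-- `φ ↦ (φ_*, Q_φ)`, for `φ = φ_* + G_* Q_φ` in `D(Ã)`. -/
def parts {z₀ : ℂ} (hz₀ : z₀.im ≠ 0) : S.domTilde z₀ →ₗ[ℂ] HPlus S.A × 𝔥 :=
  (LinearEquiv.ofInjective (S.decomp z₀) (S.decomp_injective hz₀)).symm.toLinearMap

/-- The singular perturbation `T φ = τ^* Q_φ` on `D(Ã)`. -/
def T {z₀ : ℂ} (hz₀ : z₀.im ≠ 0) : S.domTilde z₀ →ₗ[ℂ] HMinus S.A :=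
  S.tauStar.toLinearMap ∘ₗ LinearMap.snd ℂ (HPlus S.A) 𝔥 ∘ₗ S.parts hz₀

/-- The operator `Ã = Ā + T : D(Ã) ⊆ H → H₋`. -/
def Atilde {z₀ : ℂ} (hz₀ : z₀.im ≠ 0) : H →ₗ.[ℂ] HMinus S.A where
  domain := S.domTilde z₀
  toFun := (opBar S.A).toLinearMap ∘ₗ (S.domTilde z₀).subtype + S.T hz₀

/-- `D(A_Θ)`: the vectors `φ_* + G_* Q` with `φ_* ∈ D(A)`, `Q ∈ D(Θ)` and `τ φ_* = Θ Q`. -/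
def domTheta (z₀ : ℂ) (Θ : 𝔥 →ₗ.[ℂ] 𝔥) : Submodule ℂ H :=
  (Θ.graph.comap ((LinearMap.snd ℂ (HPlus S.A) 𝔥).prod
    (S.τ.toLinearMap ∘ₗ LinearMap.fst ℂ (HPlus S.A) 𝔥))).map (S.decomp z₀)

lemma mem_domTheta_iff (z₀ : ℂ) (Θ : 𝔥 →ₗ.[ℂ] 𝔥) (φ : H) :
    φ ∈ S.domTheta z₀ Θ ↔ ∃ (φs : HPlus S.A) (Q : Θ.domain),
      φ = incl S.A φs + S.Gstar z₀ Q ∧ S.τ φs = Θ Q := by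
  constructor
  · rintro ⟨⟨φs, Q⟩, hQ, rfl⟩
    obtain ⟨Q', h1, h2⟩ := (LinearPMap.mem_graph_iff Θ).mp hQ
    exact ⟨φs, Q', by rw [h1]; rfl, h2.symm⟩
  · rintro ⟨φs, Q, rfl, h⟩
    exact ⟨(φs, Q), (LinearPMap.mem_graph_iff Θ).mpr ⟨Q, rfl, h.symm⟩, rfl⟩

lemma domTheta_le (z₀ : ℂ) (Θ : 𝔥 →ₗ.[ℂ] 𝔥) : S.domTheta z₀ Θ ≤ S.domTilde z₀ :=
  LinearMap.map_le_range

/-- The operator `A_Θ φ = A φ_* + Re(z₀) G_* Q_φ + i Im(z₀) G_◇ Q_φ` on `D(A_Θ)`. -/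
def ATheta {z₀ : ℂ} (hz₀ : z₀.im ≠ 0) (Θ : 𝔥 →ₗ.[ℂ] 𝔥) : H →ₗ.[ℂ] H where
  domain := S.domTheta z₀ Θ
  toFun := ((op S.A).toLinearMap ∘ₗ LinearMap.fst ℂ (HPlus S.A) 𝔥 +
      ((z₀.re : ℂ) • S.Gstar z₀ + (Complex.I * (z₀.im : ℂ)) • S.Gdiamond z₀).toLinearMap ∘ₗ
        LinearMap.snd ℂ (HPlus S.A) 𝔥) ∘ₗ
    S.parts hz₀ ∘ₗ Submodule.inclusion (S.domTheta_le z₀ Θ)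

/-- The restriction `Ā + T_Θ` of `Ã` to `D(A_Θ)`. -/
def AThetaAdditive {z₀ : ℂ} (hz₀ : z₀.im ≠ 0) (Θ : 𝔥 →ₗ.[ℂ] 𝔥) : H →ₗ.[ℂ] HMinus S.A :=
  (S.Atilde hz₀).domRestrict (S.domTheta z₀ Θ)

/-- First resolvent identity for `G`: `G(w) - G(z) = (z - w) R(w) G(z)`. -/
lemma G_sub_G {z w : ℂ} (hz : z.im ≠ 0) (hw : w.im ≠ 0) (Q : 𝔥) :
    S.G w Q - S.G z Q = incl S.A ((z - w) • res S.A w (S.G z Q)) := by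
  refine ext_inner_left ℂ fun φ => ?_
  have hz' := S.mem_rho (z := conj z) (by simpa using hz)
  have hw' := S.mem_rho (z := conj w) (by simpa using hw)
  have hsym : ∀ f g : H, ⟪f, incl S.A (res S.A w g)⟫_ℂ = ⟪incl S.A (res S.A (conj w) f), g⟫_ℂ := by
    intro f g
    conv_lhs => rw [← res_right hw' f]
    conv_rhs => rw [← res_right (S.mem_rho hw) g]
    rw [inner_sub_left, inner_sub_right, inner_op_comm S.A S.isSelfAdjoint, inner_smul_left,
      inner_smul_right, Complex.conj_conj]
  have hres : res S.A (conj w) φ - res S.A (conj z) φ =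
      (conj z - conj w) • res S.A (conj z) (incl S.A (res S.A (conj w) φ)) := by
    set η := res S.A (conj w) φ with hη
    have h1 : (conj z) • incl S.A η - op S.A η = φ + (conj z - conj w) • incl S.A η := by
      rw [← res_right hw' φ, ← hη]; module
    have h2 := res_left hz' η
    rw [h1, map_add, map_smul] at h2
    conv_lhs => rw [← h2]
    abel
  rw [inner_sub_right, S.inner_G', S.inner_G', ← inner_sub_left, ← map_sub, hres, map_smul,
    inner_smul_left, map_smul, inner_smul_right, hsym, S.inner_G', map_sub, Complex.conj_conj,
    Complex.conj_conj]

lemma Gstar_sub_G {z₀ z : ℂ} (hz₀ : z₀.im ≠ 0) (hz : z.im ≠ 0) (Q : 𝔥) :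
    S.Gstar z₀ Q - S.G z Q = incl S.A ((1 / 2 : ℂ) • ((z - z₀) • res S.A z₀ (S.G z Q) +
      (z - conj z₀) • res S.A (conj z₀) (S.G z Q))) := by
  rw [map_smul, map_add, ← S.G_sub_G hz hz₀, ← S.G_sub_G hz (by simpa using hz₀)]
  simp only [Gstar, smul_apply, add_apply]
  module

/-- `G_* - G(z)` as an element of `B(𝔥, H₊)`. -/
def GstarSubG {z₀ z : ℂ} (hz₀ : z₀.im ≠ 0) (hz : z.im ≠ 0) : 𝔥 →L[ℂ] HPlus S.A where
  toLinearMap := LinearMap.codRestrict S.A.domain (S.Gstar z₀ - S.G z).toLinearMap fun Q => by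
    have h := S.Gstar_sub_G hz₀ hz Q
    change S.Gstar z₀ Q - S.G z Q ∈ S.A.domain
    rw [h]
    exact Subtype.property (p := fun x => x ∈ S.A.domain) _
  cont := by
    have h : ∀ Q : 𝔥, (⟨S.Gstar z₀ Q - S.G z Q, by
        rw [S.Gstar_sub_G hz₀ hz Q]
        exact Subtype.property (p := fun x => x ∈ S.A.domain) _⟩ : S.A.domain) =
        (show HPlus S.A from (1 / 2 : ℂ) • ((z - z₀) • res S.A z₀ (S.G z Q) +
          (z - conj z₀) • res S.A (conj z₀) (S.G z Q))) := fun Q =>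
      Subtype.ext (S.Gstar_sub_G hz₀ hz Q)
    have hc : Continuous fun Q : 𝔥 => (1 / 2 : ℂ) • ((z - z₀) • res S.A z₀ (S.G z Q) +
        (z - conj z₀) • res S.A (conj z₀) (S.G z Q)) := by fun_prop
    exact hc.congr fun Q => (h Q).symm

lemma incl_GstarSubG {z₀ z : ℂ} (hz₀ : z₀.im ≠ 0) (hz : z.im ≠ 0) (Q : 𝔥) :
    incl S.A (S.GstarSubG hz₀ hz Q) = S.Gstar z₀ Q - S.G z Q := rfl

/-- `Γ(z) = τ (G_* - G(z))`. -/
def Gam {z₀ z : ℂ} (hz₀ : z₀.im ≠ 0) (hz : z.im ≠ 0) : 𝔥 →L[ℂ] 𝔥 := S.τ ∘L S.GstarSubG hz₀ hz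

/-! The case `z₀ = i`. -/

lemma I_im_ne : Complex.I.im ≠ 0 := by simp

/-- `G₊ = G(i)`. -/
def Gplus : 𝔥 →L[ℂ] H := S.G Complex.I

/-- `G₋ = G(-i)`. -/
def Gminus : 𝔥 →L[ℂ] H := S.G (-Complex.I)

/-- `Γ = Γ(i)`, for `z₀ = i`. -/
def GamI : 𝔥 →L[ℂ] 𝔥 := S.Gam I_im_ne I_im_ne

/-- `𝒦₊ = Kernel (-A_𝒩^* + i)`. -/
abbrev Kplus : Submodule ℂ H := deficiency S.AN Complex.I

/-- `𝒦₋ = Kernel (-A_𝒩^* - i)`. -/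
abbrev Kminus : Submodule ℂ H := deficiency S.AN (-Complex.I)

/-- The operator `Θ - Γ` on `D(Θ)`, with the graph norm of `Θ`. -/
def thetaSubGam (Θ : 𝔥 →ₗ.[ℂ] 𝔥) : HPlus Θ →L[ℂ] 𝔥 := op Θ - S.GamI ∘L incl Θ

/-- `(Θ - Γ)⁻¹ ∈ B(𝔥)`. -/
def thetaSubGamInv (Θ : 𝔥 →ₗ.[ℂ] 𝔥) : 𝔥 →L[ℂ] 𝔥 := incl Θ ∘L (S.thetaSubGam Θ).inverse

/-- `-G₋ (1 + 2 (Θ - Γ)⁻¹ Γ) G₊⁻¹` on `𝒦₊`. -/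
def Umap (Θ : 𝔥 →ₗ.[ℂ] 𝔥) (φ : S.Kplus) : H :=
  -S.Gminus ((1 + (2 : ℂ) • (S.thetaSubGamInv Θ ∘L S.GamI)) (Function.invFun S.Gplus (φ : H)))

end ExtensionData

end Extensions

end SingularExt

/-! Everything rests on one description of `A_𝒩^*`. A pair `(φ, χ)` lies in its graph exactly when
the functional `I₋ χ - Ā φ` vanishes on `Kernel τ`. Since `τ` is onto, this means that the
functional is `τ^* Q` for some `Q`. As `Ā G(z) Q = z G(z) Q - τ^* Q`, subtracting a suitable
`G`-vector removes `τ^* Q`, and what remains lies in the graph of the self-adjoint `A`. Subtracting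
`G_* Q` yields `Ã = A_𝒩^*` (`mem_graph_AN_adjoint_iff`); subtracting `G(z) Q` identifies the
deficiency spaces (`mem_deficiency_AN_iff`).

The resolvent identity gives `Γ = i G₊^* G₊ = i G₋^* G₋`, hence `-iΓ ≥ 0` and the unitarity of
`G_±`. By the open mapping theorem `G₊` is bounded below, so `Γ` has a coercive imaginary part. The
form of `Θ` is real, so `Θ - Γ` is invertible (`isInvertible_op_sub`).

Put `R = (Θ - Γ)⁻¹ Γ Q`, so that `Θ R = Γ (Q + R)`. Reality of `⟨R, Θ R⟩` says `Re ⟨R, Q + R⟩_Γ =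
0`, that is, `Q` and `Q + 2R` have the same `Γ`-norm; hence `U` is isometric (`norm_Gplus_cayley`).
Finally `n + G₊ Q - G₋ (Q + 2R)` has `Q_φ = -2R` and, for `n ∈ 𝒩`, `τ φ_* = -2 Γ (Q + R) = Θ Q_φ`,
so `U` and `Θ` impose the same boundary condition (`vonNeumann_domain`). Self-adjointness of `A_Θ`
is that of `Θ`, carried over by Green's formula (`inner_actn_sub_inner_actn`). -/

namespace LinearPMap

/-! ### Graphs of restrictions, composites and adjoints of partially defined operators. -/

variable {R E F G : Type*} [Ring R] [AddCommGroup E] [Module R E] [AddCommGroup F] [Module R F]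
  [AddCommGroup G] [Module R G]

lemma mem_graph_domRestrict_iff (f : E →ₗ.[R] F) (p : Submodule R E) (x : E) (y : F) :
    (x, y) ∈ (f.domRestrict p).graph ↔ x ∈ p ∧ (x, y) ∈ f.graph := by
  simp only [mem_graph_iff]
  constructor
  · rintro ⟨⟨u, hu⟩, rfl, rfl⟩
    exact ⟨hu.1, ⟨u, hu.2⟩, rfl, rfl⟩
  · rintro ⟨hp, ⟨u, hu⟩, rfl, rfl⟩
    exact ⟨⟨u, hp, hu⟩, rfl, rfl⟩

lemma mem_graph_compPMap_iff (g : F →ₗ[R] G) (f : E →ₗ.[R] F) (x : E) (y : G) :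
    (x, y) ∈ (g.compPMap f).graph ↔ ∃ w, (x, w) ∈ f.graph ∧ g w = y := by
  simp only [mem_graph_iff]
  constructor
  · rintro ⟨u, rfl, rfl⟩
    exact ⟨f u, ⟨u, rfl, rfl⟩, rfl⟩
  · rintro ⟨_, ⟨u, rfl, rfl⟩, rfl⟩
    exact ⟨u, rfl, rfl⟩

lemma compPMap_domRestrict (g : F →ₗ[R] G) (f : E →ₗ.[R] F) (p : Submodule R E) :
    g.compPMap (f.domRestrict p) = (g.compPMap f).domRestrict p := by
  refine eq_of_eq_graph (Submodule.ext ?_)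
  rintro ⟨x, y⟩
  simp only [mem_graph_compPMap_iff, mem_graph_domRestrict_iff]
  constructor
  · rintro ⟨w, ⟨h1, h2⟩, h3⟩
    exact ⟨h1, w, h2, h3⟩
  · rintro ⟨h1, w, h2, h3⟩
    exact ⟨w, ⟨h1, h2⟩, h3⟩

section Adjoint

variable {H : Type*} [NormedAddCommGroup H] [InnerProductSpace ℂ H] [CompleteSpace H]

lemma mem_graph_adjoint_iff {B : H →ₗ.[ℂ] H} (hB : Dense (B.domain : Set H)) (x y : H) :
    (x, y) ∈ B.adjoint.graph ↔ ∀ a b, (a, b) ∈ B.graph → ⟪b, x⟫_ℂ = ⟪a, y⟫_ℂ := by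
  rw [adjoint_graph_eq_graph_adjoint hB, Submodule.mem_adjoint_iff]
  simp only [sub_eq_zero]

lemma isSelfAdjoint_of_mem_graph_iff {B : H →ₗ.[ℂ] H} (hB : Dense (B.domain : Set H))
    (h : ∀ x y, (∀ a b, (a, b) ∈ B.graph → ⟪b, x⟫_ℂ = ⟪a, y⟫_ℂ) ↔ (x, y) ∈ B.graph) :
    IsSelfAdjoint B := by
  rw [isSelfAdjoint_def]
  refine eq_of_eq_graph (Submodule.ext ?_)
  rintro ⟨x, y⟩
  rw [mem_graph_adjoint_iff hB, h]

lemma mem_graph_iff_of_isSelfAdjoint {B : H →ₗ.[ℂ] H} (hB : IsSelfAdjoint B) (x y : H) :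
    (x, y) ∈ B.graph ↔ ∀ a b, (a, b) ∈ B.graph → ⟪b, x⟫_ℂ = ⟪a, y⟫_ℂ := by
  rw [← mem_graph_adjoint_iff hB.dense_domain, isSelfAdjoint_def.mp hB]

lemma inner_im_eq_zero_of_mem_graph {B : H →ₗ.[ℂ] H} (hB : IsSelfAdjoint B) {x y : H}
    (h : (x, y) ∈ B.graph) : (⟪x, y⟫_ℂ).im = 0 := by
  have h1 := (mem_graph_iff_of_isSelfAdjoint hB x y).mp h x y h
  rw [← inner_conj_symm] at h1
  exact Complex.conj_eq_iff_im.mp h1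

end Adjoint

end LinearPMap

namespace SingularExt

/-! ### Self-adjoint operators and functionals in `H₋`. -/

section Scales

variable {H : Type*} [NormedAddCommGroup H] [InnerProductSpace ℂ H]

lemma mem_graph_iff_exists (A : H →ₗ.[ℂ] H) (x y : H) :
    (x, y) ∈ A.graph ↔ ∃ ψ : HPlus A, incl A ψ = x ∧ op A ψ = y :=
  LinearPMap.mem_graph_iff A

lemma incl_op_mem_graph (A : H →ₗ.[ℂ] H) (ψ : HPlus A) : (incl A ψ, op A ψ) ∈ A.graph :=
  A.mem_graph ψ

lemma incl_injective (A : H →ₗ.[ℂ] H) : Function.Injective (incl A) := inclLin_injective A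

variable [CompleteSpace H]

/-- This is `A = A^*` read in `H₋`. It serves as a regularity criterion: once `Ā φ` is known to lie
in `H`, the vector `φ` lies in `D(A)`. -/
lemma mem_graph_iff_opBar {A : H →ₗ.[ℂ] H} (hA : IsSelfAdjoint A) (φ χ : H) :
    (φ, χ) ∈ A.graph ↔ opBar A φ = iMinus A χ := by
  rw [LinearPMap.mem_graph_iff_of_isSelfAdjoint hA]
  constructor
  · intro h
    ext ψ
    exact h _ _ (incl_op_mem_graph A ψ)
  · intro h a b hab
    obtain ⟨ψ, rfl, rfl⟩ := (mem_graph_iff_exists A a b).mp hab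
    exact congrArg (fun F : HMinus A => F ψ) h

/-- A self-adjoint operator minus a bounded operator with coercive imaginary part has an
everywhere defined bounded inverse. -/
lemma isInvertible_op_sub {A : H →ₗ.[ℂ] H} (hA : IsSelfAdjoint A) (K : H →L[ℂ] H) {c : ℝ}
    (hc : 0 < c) (hK : ∀ x, c * ‖x‖ ^ 2 ≤ |(⟪x, K x⟫_ℂ).im|) :
    (op A - K ∘L incl A).IsInvertible := by
  have := hPlus_complete A hA
  set B : HPlus A →L[ℂ] H := op A - K ∘L incl A with hB
  have hBapp : ∀ ψ, B ψ = op A ψ - K (incl A ψ) := fun ψ => rfl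
  -- The form of `A` is real, so the imaginary part sees only `K`, and coercivity bounds `ψ` by `B
  -- ψ`.
  have him : ∀ ψ, (⟪incl A ψ, B ψ⟫_ℂ).im = -(⟪incl A ψ, K (incl A ψ)⟫_ℂ).im := by
    intro ψ
    rw [hBapp, inner_sub_right, Complex.sub_im,
      LinearPMap.inner_im_eq_zero_of_mem_graph hA (incl_op_mem_graph A ψ), zero_sub]
  have hincl : ∀ ψ, ‖incl A ψ‖ ≤ ‖B ψ‖ / c := by
    intro ψ
    rw [le_div_iff₀ hc, mul_comm]
    have h1 := hK (incl A ψ)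
    rw [← abs_neg, ← him] at h1
    have h2 := h1.trans ((Complex.abs_im_le_norm _).trans
      (norm_inner_le_norm (𝕜 := ℂ) (incl A ψ) (B ψ)))
    rcases (norm_nonneg (incl A ψ)).eq_or_lt with h0 | h0
    · rw [← h0, mul_zero]; exact norm_nonneg _
    · nlinarith
  have hbound : ∀ ψ, ‖ψ‖ ≤ (1 + (1 + ‖K‖) / c) * ‖B ψ‖ := by
    intro ψ
    have h2 : ‖op A ψ‖ ≤ ‖B ψ‖ + ‖K‖ * ‖incl A ψ‖ := by
      have : op A ψ = B ψ + K (incl A ψ) := by rw [hBapp, sub_add_cancel]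
      rw [this]
      exact (norm_add_le _ _).trans (by gcongr; exact K.le_opNorm _)
    have h3 : ‖ψ‖ ≤ ‖incl A ψ‖ + ‖op A ψ‖ := by
      refine le_of_sq_le_sq ?_ (by positivity)
      have h := hPlus_norm_sq A ψ
      change ‖ψ‖ ^ 2 = ‖incl A ψ‖ ^ 2 + ‖op A ψ‖ ^ 2 at h
      have := mul_nonneg (norm_nonneg (incl A ψ)) (norm_nonneg (op A ψ))
      nlinarith
    calc ‖ψ‖ ≤ (1 + ‖K‖) * ‖incl A ψ‖ + ‖B ψ‖ := by linarith
      _ ≤ (1 + ‖K‖) * (‖B ψ‖ / c) + ‖B ψ‖ := by gcongr; exact hincl ψ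
      _ = _ := by ring
  have hanti : AntilipschitzWith (Real.toNNReal (1 + (1 + ‖K‖) / c)) B :=
    AddMonoidHomClass.antilipschitz_of_bound B fun x => by
      rw [Real.coe_toNNReal _ (by positivity)]; exact hbound x
  have hclosed : IsClosed (Set.range B) := hanti.isClosed_range B.uniformContinuous
  have hortho : (B.range)ᗮ = ⊥ := by
    rw [Submodule.eq_bot_iff]
    intro y hy
    rw [Submodule.mem_orthogonal] at hy
    -- Orthogonality to the range says `A^* y = K^* y`, and `A^* = A`. Then `⟨y, K^* y⟩` is real,
    -- which coercivity allows only for `y = 0`.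
    have hgr : (y, ContinuousLinearMap.adjoint K y) ∈ A.graph := by
      rw [LinearPMap.mem_graph_iff_of_isSelfAdjoint hA]
      intro a b hab
      obtain ⟨ψ, rfl, rfl⟩ := (mem_graph_iff_exists A a b).mp hab
      have h := hy (B ψ) ⟨ψ, rfl⟩
      rw [hBapp, inner_sub_left, sub_eq_zero] at h
      rw [h, ContinuousLinearMap.adjoint_inner_right]
    have h1 := LinearPMap.inner_im_eq_zero_of_mem_graph hA hgr
    rw [ContinuousLinearMap.adjoint_inner_right, ← inner_conj_symm, Complex.conj_im,
      neg_eq_zero] at h1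
    have h2 := hK y
    rw [h1, abs_zero] at h2
    have h3 : ‖y‖ ^ 2 ≤ 0 := by
      by_contra hlt
      have := mul_pos hc (not_le.mp hlt)
      linarith
    simpa using le_antisymm h3 (sq_nonneg _)
  have hsurj : Function.Surjective B := by
    have : CompleteSpace B.range := hclosed.completeSpace_coe
    have htop := (Submodule.orthogonal_eq_bot_iff (K := B.range)).mp hortho
    exact LinearMap.range_eq_top.mp htop
  refine ⟨ContinuousLinearEquiv.ofBijective B (LinearMap.ker_eq_bot.mpr hanti.injective)
    (LinearMap.range_eq_top.mpr hsurj), ?_⟩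
  ext; rfl

/-- If a functional in `H₋` vanishes on the kernel of a surjective `L`, it belongs to the range
of the adjoint of `L`. -/
lemma exists_pairingAdjoint_eq {A : H →ₗ.[ℂ] H} (hA : IsSelfAdjoint A)
    {E : Type*} [NormedAddCommGroup E] [InnerProductSpace ℂ E] [CompleteSpace E]
    {L : HPlus A →L[ℂ] E} (hL : Function.Surjective L) {F : HMinus A}
    (hF : ∀ ψ, L ψ = 0 → F ψ = 0) : ∃ e, pairingAdjoint L e = F := by
  have := hPlus_complete A hA
  obtain ⟨g, hg⟩ := (L.toLinearMap).exists_rightInverse_of_surjective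
    (LinearMap.range_eq_top.mpr hL)
  have hg' : ∀ e, L (g e) = e := fun e => LinearMap.congr_fun hg e
  have hFg : ∀ ψ, F (g (L ψ)) = F ψ := fun ψ => by
    rw [← sub_eq_zero, ← map_sub]
    exact hF _ (by rw [map_sub, hg', sub_self])
  -- The section `g` is merely algebraic. Continuity comes from the open mapping theorem: `L` is a
  -- quotient map and `F ∘ g ∘ L = F`.
  have hcont : Continuous fun e => conj (F (g e)) := by
    refine Complex.continuous_conj.comp ((L.isQuotientMap hL).continuous_iff.mpr ?_)
    exact F.continuous.congr fun ψ => (hFg ψ).symm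
  let f : E →L[ℂ] ℂ :=
    { toFun := fun e => conj (F (g e))
      map_add' := by simp
      map_smul' := by simp
      cont := hcont }
  refine ⟨(InnerProductSpace.toDual ℂ E).symm f, ?_⟩
  ext ψ
  rw [pairingAdjoint_apply, ← inner_conj_symm, InnerProductSpace.toDual_symm_apply]
  change conj (conj (F (g (L ψ)))) = _
  rw [Complex.conj_conj, hFg]

end Scales

namespace ExtensionData

variable {H 𝔥 : Type*} [NormedAddCommGroup H] [InnerProductSpace ℂ H] [CompleteSpace H]
  [NormedAddCommGroup 𝔥] [InnerProductSpace ℂ 𝔥] (S : ExtensionData H 𝔥)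

/-! ### The restriction `A_𝒩` and the graph of its adjoint. -/

lemma mem_N_iff (φ : H) : φ ∈ S.N ↔ ∃ ψ : HPlus S.A, S.τ ψ = 0 ∧ incl S.A ψ = φ := Iff.rfl

lemma mem_graph_AN_iff (φ χ : H) :
    (φ, χ) ∈ S.AN.graph ↔ ∃ ψ : HPlus S.A, S.τ ψ = 0 ∧ incl S.A ψ = φ ∧ op S.A ψ = χ := by
  rw [AN, LinearPMap.mem_graph_domRestrict_iff, mem_N_iff, mem_graph_iff_exists]
  constructor
  · rintro ⟨⟨ψ, h1, h2⟩, ψ', h3, h4⟩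
    obtain rfl := incl_injective S.A (h2.trans h3.symm)
    exact ⟨ψ, h1, h2, h4⟩
  · rintro ⟨ψ, h1, h2, h3⟩
    exact ⟨⟨ψ, h1, h2⟩, ψ, h2, h3⟩

lemma AN_domain : S.AN.domain = S.N := by
  refine inf_eq_left.mpr ?_
  rintro _ ⟨ψ, -, rfl⟩
  exact Subtype.property (p := fun x => x ∈ S.A.domain) ψ

lemma dense_AN_domain : Dense (S.AN.domain : Set H) := by
  rw [AN_domain]
  exact S.dense_ker_τ

lemma mem_graph_AN_adjoint_iff_ker (φ χ : H) :
    (φ, χ) ∈ S.AN.adjoint.graph ↔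
      ∀ ψ, S.τ ψ = 0 → opBar S.A φ ψ = iMinus S.A χ ψ := by
  rw [LinearPMap.mem_graph_adjoint_iff S.dense_AN_domain]
  constructor
  · intro h ψ hψ
    exact h _ _ ((S.mem_graph_AN_iff _ _).mpr ⟨ψ, hψ, rfl, rfl⟩)
  · intro h a b hab
    obtain ⟨ψ, hψ, rfl, rfl⟩ := (S.mem_graph_AN_iff _ _).mp hab
    exact h ψ hψ

variable [CompleteSpace 𝔥]

/-- A functional that annihilates `Kernel τ` is in the range of `τ^*`, because `τ` is onto. -/
lemma mem_graph_AN_adjoint_iff_tauStar (φ χ : H) :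
    (φ, χ) ∈ S.AN.adjoint.graph ↔
      ∃ Q, opBar S.A φ = iMinus S.A χ - S.tauStar Q := by
  rw [mem_graph_AN_adjoint_iff_ker]
  constructor
  · intro h
    obtain ⟨Q, hQ⟩ := exists_pairingAdjoint_eq S.isSelfAdjoint S.surjective_τ
      (F := iMinus S.A χ - opBar S.A φ) fun ψ hψ => sub_eq_zero.mpr (h ψ hψ).symm
    exact ⟨Q, by rw [tauStar, hQ]; abel⟩
  · rintro ⟨Q, hQ⟩ ψ hψ
    rw [hQ]
    change iMinus S.A χ ψ - ⟪S.τ ψ, Q⟫_ℂ = _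
    rw [hψ, inner_zero_left, sub_zero]

lemma Gstar_I (Q : 𝔥) : S.Gstar Complex.I Q = (1 / 2 : ℂ) • (S.Gplus Q + S.Gminus Q) := by
  simp [Gstar, Gplus, Gminus]

lemma Gdiamond_I (Q : 𝔥) : S.Gdiamond Complex.I Q = (1 / 2 : ℂ) • (S.Gplus Q - S.Gminus Q) := by
  simp [Gdiamond, Gplus, Gminus]

lemma opBar_Gplus (Q : 𝔥) :
    opBar S.A (S.Gplus Q) = Complex.I • iMinus S.A (S.Gplus Q) - S.tauStar Q :=
  S.opBar_G (by simp) Q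

lemma opBar_Gminus (Q : 𝔥) :
    opBar S.A (S.Gminus Q) = (-Complex.I) • iMinus S.A (S.Gminus Q) - S.tauStar Q :=
  S.opBar_G (by simp) Q

/-- The vector `A φ_* + i G_◇ Q`, as a function of `(φ_*, Q)`. -/
def actn (p : HPlus S.A × 𝔥) : H := op S.A p.1 + Complex.I • S.Gdiamond Complex.I p.2

/-- Averaging `Ā G_± = ±i G_± - τ^*` turns the eigenvalue terms into `i G_◇` and leaves `τ^*`
intact. -/
lemma opBar_decomp (p : HPlus S.A × 𝔥) :
    opBar S.A (S.decomp Complex.I p) = iMinus S.A (S.actn p) - S.tauStar p.2 := by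
  rw [decomp_apply, actn, Gstar_I, Gdiamond_I]
  simp only [map_add, map_smul, map_sub, opBar_incl S.A S.isSelfAdjoint, opBar_Gplus,
    opBar_Gminus]
  module

/-- The pair `(G_* Q, i G_◇ Q)` carries the same `τ^* Q` as `(φ, χ)`, so their difference lies in
the graph of `A`. -/
lemma mem_graph_AN_adjoint_iff (φ χ : H) :
    (φ, χ) ∈ S.AN.adjoint.graph ↔ ∃ p, S.decomp Complex.I p = φ ∧ S.actn p = χ := by
  rw [mem_graph_AN_adjoint_iff_tauStar]
  constructor
  · rintro ⟨Q, hQ⟩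
    have h : (φ - S.Gstar Complex.I Q, χ - Complex.I • S.Gdiamond Complex.I Q) ∈ S.A.graph := by
      rw [mem_graph_iff_opBar S.isSelfAdjoint]
      have h1 := S.opBar_decomp (0, Q)
      simp only [decomp_apply, actn, map_zero, zero_add] at h1
      rw [map_sub, map_sub, hQ, h1]
      abel
    obtain ⟨ψ, h1, h2⟩ := (mem_graph_iff_exists S.A _ _).mp h
    exact ⟨(ψ, Q), by rw [decomp_apply, h1, sub_add_cancel], by rw [actn, h2, sub_add_cancel]⟩
  · rintro ⟨p, rfl, rfl⟩
    exact ⟨p.2, S.opBar_decomp p⟩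

lemma parts_decomp {z₀ : ℂ} (hz₀ : z₀.im ≠ 0) (p : HPlus S.A × 𝔥)
    (h : S.decomp z₀ p ∈ S.domTilde z₀) :
    S.parts hz₀ ⟨S.decomp z₀ p, h⟩ = p :=
  (LinearEquiv.ofInjective (S.decomp z₀) (S.decomp_injective hz₀)).symm_apply_apply p

/-- The perturbation `T` cancels the term `-τ^* Q` of `opBar_decomp`, which brings the values back
into `H`. -/
lemma mem_graph_Atilde_iff (φ : H) (F : HMinus S.A) :
    (φ, F) ∈ (S.Atilde I_im_ne).graph ↔
      ∃ p, S.decomp Complex.I p = φ ∧ iMinus S.A (S.actn p) = F := by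
  have key : ∀ p h, S.Atilde I_im_ne ⟨S.decomp Complex.I p, h⟩ = iMinus S.A (S.actn p) := by
    intro p h
    refine (congrArg (fun q : HPlus S.A × 𝔥 => opBar S.A (S.decomp Complex.I p) + S.tauStar q.2)
      (S.parts_decomp I_im_ne p h)).trans ?_
    rw [opBar_decomp, sub_add_cancel]
  rw [LinearPMap.mem_graph_iff]
  constructor
  · rintro ⟨⟨_, p, rfl⟩, rfl, rfl⟩
    exact ⟨p, rfl, (key p _).symm⟩
  · rintro ⟨p, rfl, rfl⟩
    exact ⟨⟨_, p, rfl⟩, rfl, key p _⟩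

lemma Atilde_eq : S.Atilde I_im_ne = (iMinus S.A).toLinearMap.compPMap S.AN.adjoint := by
  refine LinearPMap.eq_of_eq_graph (Submodule.ext ?_)
  rintro ⟨φ, F⟩
  rw [mem_graph_Atilde_iff, LinearPMap.mem_graph_compPMap_iff]
  simp only [mem_graph_AN_adjoint_iff]
  constructor
  · rintro ⟨p, h1, h2⟩
    exact ⟨_, ⟨p, h1, rfl⟩, h2⟩
  · rintro ⟨_, ⟨p, h1, rfl⟩, h2⟩
    exact ⟨p, h1, h2⟩

lemma mem_domTheta_iff_graph (z₀ : ℂ) (Θ : 𝔥 →ₗ.[ℂ] 𝔥) (φ : H) :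
    φ ∈ S.domTheta z₀ Θ ↔ ∃ p, (p.2, S.τ p.1) ∈ Θ.graph ∧ S.decomp z₀ p = φ := Iff.rfl

lemma mem_graph_ATheta_iff (Θ : 𝔥 →ₗ.[ℂ] 𝔥) (φ χ : H) :
    (φ, χ) ∈ (S.ATheta I_im_ne Θ).graph ↔
      ∃ p, (p.2, S.τ p.1) ∈ Θ.graph ∧ S.decomp Complex.I p = φ ∧ S.actn p = χ := by
  have key : ∀ p h, S.ATheta I_im_ne Θ ⟨S.decomp Complex.I p, h⟩ = S.actn p := by
    intro p h
    have h1 : S.parts I_im_ne (Submodule.inclusion (S.domTheta_le Complex.I Θ) ⟨_, h⟩) = p :=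
      S.parts_decomp I_im_ne p (S.domTheta_le Complex.I Θ h)
    refine (congrArg (fun q : HPlus S.A × 𝔥 => op S.A q.1 + ((Complex.I.re : ℂ) •
      S.Gstar Complex.I + (Complex.I * (Complex.I.im : ℂ)) • S.Gdiamond Complex.I) q.2) h1).trans ?_
    simp [actn]
  rw [LinearPMap.mem_graph_iff]
  constructor
  · rintro ⟨⟨_, p, hp, rfl⟩, rfl, rfl⟩
    exact ⟨p, hp, rfl, (key p _).symm⟩
  · rintro ⟨p, hp, rfl, rfl⟩
    exact ⟨⟨_, p, hp, rfl⟩, rfl, key p _⟩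

lemma ATheta_eq_domRestrict (Θ : 𝔥 →ₗ.[ℂ] 𝔥) :
    S.ATheta I_im_ne Θ = S.AN.adjoint.domRestrict (S.domTheta Complex.I Θ) := by
  refine LinearPMap.eq_of_eq_graph (Submodule.ext ?_)
  rintro ⟨φ, χ⟩
  rw [mem_graph_ATheta_iff, LinearPMap.mem_graph_domRestrict_iff, mem_graph_AN_adjoint_iff,
    mem_domTheta_iff_graph]
  constructor
  · rintro ⟨p, h1, h2, h3⟩
    exact ⟨⟨p, h1, h2⟩, p, h2, h3⟩
  · rintro ⟨⟨p, h1, h2⟩, p', h3, h4⟩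
    obtain rfl := S.decomp_injective I_im_ne (h2.trans h3.symm)
    exact ⟨p, h1, h2, h4⟩

/-! ### Deficiency spaces as ranges of `G(z)`. -/

/-- If `A_𝒩^* φ = z φ` with functional `τ^* Q`, then `φ - G(z) Q` satisfies the eigenvalue equation
of `A` at the nonreal `z`, hence vanishes. -/
lemma mem_deficiency_AN_iff {z : ℂ} (hz : z.im ≠ 0) (φ : H) :
    φ ∈ deficiency S.AN z ↔ ∃ Q, S.G z Q = φ := by
  have h0 : φ ∈ deficiency S.AN z ↔ (φ, z • φ) ∈ S.AN.adjoint.graph := by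
    rw [mem_deficiency_iff, LinearPMap.mem_graph_iff]
    constructor
    · rintro ⟨h, h'⟩
      exact ⟨⟨φ, h⟩, rfl, h'⟩
    · rintro ⟨⟨_, h⟩, rfl, h'⟩
      exact ⟨h, h'⟩
  rw [h0, mem_graph_AN_adjoint_iff_tauStar]
  constructor
  · rintro ⟨Q, hQ⟩
    refine ⟨Q, ?_⟩
    have hg : (φ - S.G z Q, z • (φ - S.G z Q)) ∈ S.A.graph := by
      rw [mem_graph_iff_opBar S.isSelfAdjoint, map_sub, hQ, S.opBar_G hz, smul_sub, map_sub,
        map_smul, map_smul]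
      abel
    obtain ⟨ψ, h1, h2⟩ := (mem_graph_iff_exists S.A _ _).mp hg
    have h3 := res_left (S.mem_rho hz) ψ
    rw [h1, h2, sub_self, map_zero] at h3
    rw [← h3, map_zero] at h1
    exact (sub_eq_zero.mp h1.symm).symm
  · rintro ⟨Q, rfl⟩
    exact ⟨Q, by rw [S.opBar_G hz, map_smul]⟩

lemma G_injective {z : ℂ} (hz : z.im ≠ 0) : Function.Injective (S.G z) := by
  rw [injective_iff_map_eq_zero]
  intro Q hQ
  have h := S.opBar_G hz Q
  rw [hQ, map_zero, map_zero] at h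
  have h : S.tauStar Q = 0 := by
    rw [← neg_eq_zero, h]
    module
  exact S.eq_zero_of_tauStar (χ := 0) (by rw [h, map_zero])

lemma bijOn_G {z : ℂ} (hz : z.im ≠ 0) :
    Set.BijOn (S.G z) Set.univ (deficiency S.AN z : Set H) := by
  refine ⟨fun Q _ => (S.mem_deficiency_AN_iff hz _).mpr ⟨Q, rfl⟩, (S.G_injective hz).injOn, ?_⟩
  intro φ hφ
  obtain ⟨Q, hQ⟩ := (S.mem_deficiency_AN_iff hz _).mp hφ
  exact ⟨Q, trivial, hQ⟩

/-- `G(z)` is the adjoint of the surjection `Ğ(z̄)`. The open mapping theorem provides preimages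
with `‖φ‖ ≤ C ‖Q‖`, and testing `G(z) Q` against such a preimage of `Q` gives the bound with `c =
C⁻²`. -/
lemma exists_norm_le_norm_G {z : ℂ} (hz : z.im ≠ 0) :
    ∃ c > 0, ∀ Q, c * ‖Q‖ ^ 2 ≤ ‖S.G z Q‖ ^ 2 := by
  have hz' : (conj z).im ≠ 0 := by simpa using hz
  have hsurj : Function.Surjective (S.Gbreve (conj z)) := by
    intro Q
    obtain ⟨ψ, rfl⟩ := S.surjective_τ Q
    exact ⟨_, congrArg S.τ (res_left (S.mem_rho hz') ψ)⟩
  obtain ⟨C, hC, h⟩ := (S.Gbreve (conj z)).exists_preimage_norm_le hsurj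
  refine ⟨(C ^ 2)⁻¹, by positivity, fun Q => ?_⟩
  have hQ : ‖Q‖ ≤ C * ‖S.G z Q‖ := by
    obtain ⟨φ, h1, h2⟩ := h Q
    have h3 : ‖Q‖ ^ 2 ≤ ‖S.G z Q‖ * (C * ‖Q‖) := by
      have h4 : ⟪S.G z Q, φ⟫_ℂ = ⟪Q, Q⟫_ℂ := by rw [S.inner_G]; exact congrArg _ h1
      have h5 := norm_inner_le_norm (𝕜 := ℂ) (S.G z Q) φ
      rw [h4, inner_self_eq_norm_sq_to_K] at h5
      simp only [norm_pow, RCLike.norm_ofReal, abs_norm] at h5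
      exact h5.trans (by gcongr)
    rcases (norm_nonneg Q).eq_or_lt with h0 | h0
    · rw [← h0]; positivity
    · nlinarith
  rw [inv_mul_le_iff₀ (by positivity), ← mul_pow]
  gcongr

/-! ### The operator `Γ` and the scalar product it defines. -/

/-- `G_* - G_+`, with values in `H₊`. -/
abbrev D : 𝔥 →L[ℂ] HPlus S.A := S.GstarSubG I_im_ne I_im_ne

lemma incl_D (Q : 𝔥) : incl S.A (S.D Q) = (1 / 2 : ℂ) • (S.Gminus Q - S.Gplus Q) := by
  rw [incl_GstarSubG, Gstar_I]
  change _ - S.Gplus Q = _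
  module

/-- Resolvent identity between `i` and `-i`: the factor is half of the difference `2i`. -/
lemma D_eq_res_Gplus (Q : 𝔥) : S.D Q = Complex.I • res S.A (-Complex.I) (S.Gplus Q) := by
  refine incl_injective S.A ?_
  rw [incl_D, Gplus, Gminus, S.G_sub_G (z := Complex.I) (w := -Complex.I) (by simp) (by simp)]
  simp only [map_smul]
  module

lemma D_eq_res_Gminus (Q : 𝔥) : S.D Q = Complex.I • res S.A Complex.I (S.Gminus Q) := by
  refine incl_injective S.A ?_
  rw [incl_D, ← neg_sub, Gplus, Gminus, S.G_sub_G (z := -Complex.I) (w := Complex.I) (by simp)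
    (by simp)]
  simp only [map_smul]
  module

lemma GamI_apply (Q : 𝔥) : S.GamI Q = S.τ (S.D Q) := rfl

/-- By the preceding formula `Γ = i τ R(-i) G₊`, and `τ R(-i) = Ğ(-i)` is the adjoint of `G₊`. -/
lemma inner_GamI_eq_Gplus (Q₁ Q₂ : 𝔥) :
    ⟪Q₁, S.GamI Q₂⟫_ℂ = Complex.I * ⟪S.Gplus Q₁, S.Gplus Q₂⟫_ℂ := by
  rw [GamI_apply, D_eq_res_Gplus, map_smul, inner_smul_right]
  congr 1
  conv_rhs => rw [Gplus, S.inner_G]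
  simp [Gplus]

lemma inner_GamI_eq_Gminus (Q₁ Q₂ : 𝔥) :
    ⟪Q₁, S.GamI Q₂⟫_ℂ = Complex.I * ⟪S.Gminus Q₁, S.Gminus Q₂⟫_ℂ := by
  rw [GamI_apply, D_eq_res_Gminus, map_smul, inner_smul_right]
  congr 1
  conv_rhs => rw [Gminus, S.inner_G]
  simp [Gminus]

lemma inner_Gminus_eq_Gplus (Q₁ Q₂ : 𝔥) :
    ⟪S.Gminus Q₁, S.Gminus Q₂⟫_ℂ = ⟪S.Gplus Q₁, S.Gplus Q₂⟫_ℂ := by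
  have h := (S.inner_GamI_eq_Gminus Q₁ Q₂).symm.trans (S.inner_GamI_eq_Gplus Q₁ Q₂)
  exact mul_left_cancel₀ Complex.I_ne_zero h

lemma neg_I_smul_GamI :
    -(Complex.I • S.GamI) = ContinuousLinearMap.adjoint S.Gplus ∘L S.Gplus := by
  ext Q
  refine ext_inner_left ℂ fun Q' => ?_
  change ⟪Q', -(Complex.I • S.GamI Q)⟫_ℂ = ⟪Q', ContinuousLinearMap.adjoint S.Gplus (S.Gplus Q)⟫_ℂ
  rw [inner_neg_right, inner_smul_right, inner_GamI_eq_Gplus,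
    ContinuousLinearMap.adjoint_inner_right, ← mul_assoc, Complex.I_mul_I]
  ring

lemma neg_I_smul_GamI_nonneg : 0 ≤ -(Complex.I • S.GamI) := by
  rw [neg_I_smul_GamI, ContinuousLinearMap.nonneg_iff_isPositive]
  exact ContinuousLinearMap.isPositive_adjoint_comp_self _

lemma inner_Gplus_eq_sqrt (Q₁ Q₂ : 𝔥) : ⟪S.Gplus Q₁, S.Gplus Q₂⟫_ℂ =
    ⟪CFC.sqrt (-(Complex.I • S.GamI)) Q₁, CFC.sqrt (-(Complex.I • S.GamI)) Q₂⟫_ℂ := by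
  have hs := CFC.sqrt_mul_sqrt_self _ S.neg_I_smul_GamI_nonneg
  have hsa : ContinuousLinearMap.adjoint (CFC.sqrt (-(Complex.I • S.GamI))) =
      CFC.sqrt (-(Complex.I • S.GamI)) :=
    (IsSelfAdjoint.of_nonneg (CFC.sqrt_nonneg _)).adjoint_eq
  rw [← ContinuousLinearMap.adjoint_inner_right (CFC.sqrt _), hsa, ← mul_apply_eq_comp, hs,
    neg_I_smul_GamI]
  exact (ContinuousLinearMap.adjoint_inner_right _ _ _).symm

lemma exists_coercive_GamI : ∃ c > 0, ∀ Q, c * ‖Q‖ ^ 2 ≤ |(⟪Q, S.GamI Q⟫_ℂ).im| := by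
  obtain ⟨c, hc, h⟩ := S.exists_norm_le_norm_G I_im_ne
  refine ⟨c, hc, fun Q => (h Q).trans ?_⟩
  rw [inner_GamI_eq_Gplus, inner_self_eq_norm_sq_to_K]
  simp [← Complex.ofReal_pow, Gplus]

/-- Lax–Milgram. Surjectivity is what lets every vector of `D(A_Θ)` be reached from `𝒩 ⊕ Graph U`.
-/
lemma GamI_surjective : Function.Surjective S.GamI := by
  obtain ⟨c, hc, h⟩ := S.exists_coercive_GamI
  have hu : IsUnit S.GamI :=
    ContinuousLinearMap.isUnit_of_forall_le_norm_inner_map _ (c := ⟨c, hc.le⟩) hc fun Q => by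
      rw [norm_inner_symm, mul_comm]
      exact (h Q).trans (Complex.abs_im_le_norm _)
  exact (ContinuousLinearMap.isUnit_iff_bijective.mp hu).2

/-! ### The transform `1 + 2 (Θ - Γ)⁻¹ Γ` and the unitary `U`. -/

section Theta

variable {Θ : 𝔥 →ₗ.[ℂ] 𝔥}

lemma isInvertible_thetaSubGam (hΘ : IsSelfAdjoint Θ) : (S.thetaSubGam Θ).IsInvertible := by
  obtain ⟨c, hc, h⟩ := S.exists_coercive_GamI
  exact isInvertible_op_sub hΘ S.GamI hc h

/-- `(Θ - Γ) R = Γ Q` is solvable in the domain of `Θ`, with `R = (Θ - Γ)⁻¹ Γ Q`. -/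
lemma thetaSubGamInv_mem_graph (hΘ : IsSelfAdjoint Θ) (Q : 𝔥) :
    (S.thetaSubGamInv Θ (S.GamI Q), S.GamI (Q + S.thetaSubGamInv Θ (S.GamI Q))) ∈ Θ.graph := by
  rw [mem_graph_iff_exists]
  refine ⟨(S.thetaSubGam Θ).inverse (S.GamI Q), rfl, ?_⟩
  have h := (S.isInvertible_thetaSubGam hΘ).self_apply_inverse (S.GamI Q)
  change op Θ _ - S.GamI (incl Θ _) = _ at h
  rw [sub_eq_iff_eq_add] at h
  rw [h, map_add]
  rfl

/-- Allows the inverse to be evaluated by exhibiting a solution of `Θ R = Γ (Q + R)`. -/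
lemma thetaSubGamInv_eq (hΘ : IsSelfAdjoint Θ) {Q R : 𝔥} (h : (R, S.GamI (Q + R)) ∈ Θ.graph) :
    S.thetaSubGamInv Θ (S.GamI Q) = R := by
  obtain ⟨ρ, rfl, h2⟩ := (mem_graph_iff_exists Θ _ _).mp h
  have h3 : S.thetaSubGam Θ ρ = S.GamI Q := by
    change op Θ ρ - S.GamI (incl Θ ρ) = _
    rw [h2, map_add, add_sub_cancel_right]
  rw [← h3]
  exact congrArg (incl Θ) ((S.isInvertible_thetaSubGam hΘ).inverse_apply_self ρ)

/-- `1 + 2 (Θ - Γ)⁻¹ Γ`. -/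
def cayley (Θ : 𝔥 →ₗ.[ℂ] 𝔥) : 𝔥 →L[ℂ] 𝔥 := 1 + (2 : ℂ) • (S.thetaSubGamInv Θ ∘L S.GamI)

lemma cayley_apply (Q : 𝔥) :
    S.cayley Θ Q = Q + (2 : ℂ) • S.thetaSubGamInv Θ (S.GamI Q) := rfl

/-- Substituting `Q = Q' - 2R` in `(Θ - Γ) R = Γ Q` gives `(Θ + Γ) R = Γ Q'`. This is solvable
because `-Γ` is as coercive as `Γ`. -/
lemma cayley_surjective (hΘ : IsSelfAdjoint Θ) : Function.Surjective (S.cayley Θ) := by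
  intro Q'
  obtain ⟨c, hc, h⟩ := S.exists_coercive_GamI
  have hinv : (op Θ - (-S.GamI) ∘L incl Θ).IsInvertible :=
    isInvertible_op_sub hΘ (-S.GamI) hc fun Q => by
      simpa only [neg_apply, inner_neg_right, Complex.neg_im, abs_neg] using h Q
  set ρ := (op Θ - (-S.GamI) ∘L incl Θ).inverse (S.GamI Q')
  have hρ : op Θ ρ - -S.GamI (incl Θ ρ) = S.GamI Q' := hinv.self_apply_inverse (S.GamI Q')
  have hR : S.thetaSubGamInv Θ (S.GamI (Q' - (2 : ℂ) • incl Θ ρ)) = incl Θ ρ := by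
    refine S.thetaSubGamInv_eq hΘ ((mem_graph_iff_exists Θ _ _).mpr ⟨ρ, rfl, ?_⟩)
    rw [sub_neg_eq_add, ← eq_sub_iff_add_eq, ← map_sub] at hρ
    rw [hρ]
    congr 1
    module
  refine ⟨Q' - (2 : ℂ) • incl Θ ρ, ?_⟩
  rw [cayley_apply, hR, sub_add_cancel]

/-- Since `⟨R, Θ R⟩ = i ⟨G₊ R, G₊ (Q + R)⟩` is real, `Re ⟨G₊ R, G₊ (Q + R)⟩ = 0`. This is exactly
the cross term in `‖G₊ (Q + 2R)‖² - ‖G₊ Q‖²`, up to a factor `4`. -/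
lemma norm_Gplus_cayley (hΘ : IsSelfAdjoint Θ) (Q : 𝔥) :
    ‖S.Gplus (S.cayley Θ Q)‖ = ‖S.Gplus Q‖ := by
  set R := S.thetaSubGamInv Θ (S.GamI Q) with hR
  have h1 := LinearPMap.inner_im_eq_zero_of_mem_graph hΘ (S.thetaSubGamInv_mem_graph hΘ Q)
  rw [← hR, inner_GamI_eq_Gplus] at h1
  have h2 : (⟪S.Gplus R, S.Gplus Q + S.Gplus R⟫_ℂ).re = 0 := by
    simpa [Complex.mul_im] using h1
  rw [inner_add_right, Complex.add_re] at h2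
  have h3 : (⟪S.Gplus R, S.Gplus R⟫_ℂ).re = ‖S.Gplus R‖ ^ 2 :=
    inner_self_eq_norm_sq (𝕜 := ℂ) (S.Gplus R)
  have h4 := norm_add_sq (𝕜 := ℂ) (S.Gplus Q) ((2 : ℂ) • S.Gplus R)
  rw [inner_smul_right, norm_smul, ← inner_conj_symm] at h4
  have h5 : RCLike.re ((2 : ℂ) * conj ⟪S.Gplus R, S.Gplus Q⟫_ℂ) =
      2 * (⟪S.Gplus R, S.Gplus Q⟫_ℂ).re := by
    rw [inner_conj_symm, ← RCLike.re_eq_complex_re, inner_re_symm]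
    simp
  have h6 : ‖(2 : ℂ)‖ = 2 := by simp
  refine (sq_eq_sq₀ (norm_nonneg _) (norm_nonneg _)).mp ?_
  rw [cayley_apply, map_add, map_smul, ← hR, h4, h5, h6]
  linarith

lemma norm_Gminus (Q : 𝔥) : ‖S.Gminus Q‖ = ‖S.Gplus Q‖ := by
  rw [@norm_eq_sqrt_re_inner ℂ, @norm_eq_sqrt_re_inner ℂ, inner_Gminus_eq_Gplus]

/-- `G₊` as an isomorphism of `𝔥` onto `𝒦₊`. -/
def GplusEquiv : 𝔥 ≃ₗ[ℂ] S.Kplus :=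
  LinearEquiv.ofBijective
    (S.Gplus.toLinearMap.codRestrict S.Kplus fun Q => (S.bijOn_G I_im_ne).mapsTo (Set.mem_univ Q))
    ⟨fun _ _ h => S.G_injective I_im_ne (congrArg Subtype.val h), fun φ => by
      obtain ⟨Q, -, hQ⟩ := (S.bijOn_G I_im_ne).surjOn φ.2
      exact ⟨Q, Subtype.ext hQ⟩⟩

lemma coe_GplusEquiv (Q : 𝔥) : (S.GplusEquiv Q : H) = S.Gplus Q := rfl

/-- The default value of `Function.invFun` is never met, since `𝒦₊` is the range of `G₊`. -/
lemma invFun_Gplus (φ : S.Kplus) :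
    Function.invFun S.Gplus (φ : H) = S.GplusEquiv.symm φ := by
  obtain ⟨Q, rfl⟩ := S.GplusEquiv.surjective φ
  rw [LinearEquiv.symm_apply_apply, coe_GplusEquiv]
  exact Function.leftInverse_invFun (S.G_injective I_im_ne) Q

lemma bijOn_Gminus : Set.BijOn S.Gminus Set.univ (S.Kminus : Set H) :=
  S.bijOn_G (z := -Complex.I) (by simp)

/-- `U = -G₋ (1 + 2 (Θ - Γ)⁻¹ Γ) G₊⁻¹`, as a linear map from `𝒦₊` to `𝒦₋`. -/
def Ulin (Θ : 𝔥 →ₗ.[ℂ] 𝔥) : S.Kplus →ₗ[ℂ] S.Kminus :=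
  (-(S.Gminus.toLinearMap ∘ₗ (S.cayley Θ).toLinearMap ∘ₗ
    S.GplusEquiv.symm.toLinearMap)).codRestrict S.Kminus fun _ =>
      S.Kminus.neg_mem (S.bijOn_Gminus.mapsTo (Set.mem_univ _))

lemma coe_Ulin_GplusEquiv (Q : 𝔥) :
    (S.Ulin Θ (S.GplusEquiv Q) : H) = -S.Gminus (S.cayley Θ Q) := by
  change -S.Gminus (S.cayley Θ (S.GplusEquiv.symm (S.GplusEquiv Q))) = _
  rw [LinearEquiv.symm_apply_apply]

lemma norm_Ulin (hΘ : IsSelfAdjoint Θ) (φ : S.Kplus) : ‖S.Ulin Θ φ‖ = ‖φ‖ := by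
  obtain ⟨Q, rfl⟩ := S.GplusEquiv.surjective φ
  rw [← Submodule.norm_coe, ← Submodule.norm_coe, coe_Ulin_GplusEquiv, norm_neg, norm_Gminus,
    norm_Gplus_cayley S hΘ, coe_GplusEquiv]

lemma Ulin_surjective (hΘ : IsSelfAdjoint Θ) : Function.Surjective (S.Ulin Θ) := by
  intro φ
  obtain ⟨Q', -, hQ'⟩ := S.bijOn_Gminus.surjOn φ.2
  obtain ⟨Q, hQ⟩ := S.cayley_surjective hΘ (-Q')
  exact ⟨S.GplusEquiv Q, Subtype.ext (by rw [coe_Ulin_GplusEquiv, hQ, map_neg, neg_neg, hQ'])⟩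

/-- The unitary map `U` from `𝒦₊` onto `𝒦₋` that corresponds to `Θ`. -/
def Uiso (hΘ : IsSelfAdjoint Θ) : S.Kplus ≃ₗᵢ[ℂ] S.Kminus :=
  LinearIsometryEquiv.ofSurjective ⟨S.Ulin Θ, S.norm_Ulin hΘ⟩ (S.Ulin_surjective hΘ)

lemma coe_Uiso (hΘ : IsSelfAdjoint Θ) (φ : S.Kplus) : (S.Uiso hΘ φ : H) = S.Umap Θ φ := by
  rw [Umap, invFun_Gplus]
  rfl

/-! ### The equality `A_U = A_Θ`. -/

/-- `G₊ Q - G₋ (Q + 2 R)` decomposed along `D(A)` and the range of `G_*`. -/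
lemma Gplus_sub_Gminus_eq_decomp (n : HPlus S.A) (Q R : 𝔥) :
    incl S.A n + (S.Gplus Q + -S.Gminus (Q + (2 : ℂ) • R)) =
      S.decomp Complex.I (n - (2 : ℂ) • S.D (Q + R), -((2 : ℂ) • R)) := by
  rw [decomp_apply, Gstar_I, map_sub, map_smul, incl_D]
  simp only [map_add, map_smul, map_neg]
  module

lemma vonNeumann_domain (hΘ : IsSelfAdjoint Θ) :
    S.AN.domain ⊔ LinearMap.range (S.Kplus.subtype +
      S.Kminus.subtype ∘ₗ (S.Uiso hΘ).toLinearEquiv.toLinearMap) = S.domTheta Complex.I Θ := by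
  ext φ
  rw [AN_domain, Submodule.mem_sup, mem_domTheta_iff_graph]
  constructor
  · rintro ⟨_, ⟨n, hn, rfl⟩, _, ⟨φ', rfl⟩, rfl⟩
    obtain ⟨Q, rfl⟩ := S.GplusEquiv.surjective φ'
    set R := S.thetaSubGamInv Θ (S.GamI Q) with hR
    have hn : S.τ n = 0 := hn
    refine ⟨(n - (2 : ℂ) • S.D (Q + R), -((2 : ℂ) • R)), ?_, ?_⟩
    · have h := Θ.graph.smul_mem (-2 : ℂ) (S.thetaSubGamInv_mem_graph hΘ Q)
      rw [← hR] at h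
      convert h using 1
      refine Prod.ext ?_ ?_
      · simp
      · simp [hn, GamI_apply]
    · rw [← Gplus_sub_Gminus_eq_decomp]
      change _ = incl S.A n + (S.Gplus Q + (S.Ulin Θ (S.GplusEquiv Q) : H))
      rw [coe_Ulin_GplusEquiv, cayley_apply]
  · rintro ⟨⟨φs, Q₀⟩, hp, rfl⟩
    -- The formulas of the first inclusion are solved backwards: `Q₀ = -2R` fixes `R`, then `τ φ_* =
    -- -2 Γ (Q + R)` fixes `Q`, and the component in `𝒩` is `φ_* + 2 (G_* - G₊)(Q + R)`.
    set R : 𝔥 := (-1 / 2 : ℂ) • Q₀ with hR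
    obtain ⟨Q', hQ'⟩ := S.GamI_surjective ((-1 / 2 : ℂ) • S.τ φs)
    set Q := Q' - R
    have hQ : S.GamI (Q + R) = (-1 / 2 : ℂ) • S.τ φs := by rw [sub_add_cancel, hQ']
    have hRΘ : (R, S.GamI (Q + R)) ∈ Θ.graph := by
      rw [hQ]
      exact Θ.graph.smul_mem (-1 / 2 : ℂ) hp
    refine ⟨incl S.A (φs + (2 : ℂ) • S.D (Q + R)), ⟨_, ?_, rfl⟩, _,
      ⟨S.GplusEquiv Q, rfl⟩, ?_⟩
    · change S.τ _ = 0
      rw [map_add, map_smul, ← GamI_apply, hQ]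
      module
    · change incl S.A _ + (S.Gplus Q + (S.Ulin Θ (S.GplusEquiv Q) : H)) = _
      rw [coe_Ulin_GplusEquiv, cayley_apply, S.thetaSubGamInv_eq hΘ hRΘ,
        Gplus_sub_Gminus_eq_decomp, add_sub_cancel_right]
      congr 2
      rw [hR]
      module

/-- Both operators are restrictions of `A_𝒩^*`, so only the domains need comparing. -/
lemma vonNeumann_eq (hΘ : IsSelfAdjoint Θ) :
    vonNeumann S.AN (S.Uiso hΘ) = S.ATheta I_im_ne Θ := by
  rw [vonNeumann, ATheta_eq_domRestrict]
  exact congrArg _ (S.vonNeumann_domain hΘ)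

/-! ### Green's formula and self-adjointness of `A_Θ`. -/

/-- Green's formula for the adjoint of `A_𝒩`. -/
lemma inner_actn_sub_inner_actn (p q : HPlus S.A × 𝔥) :
    ⟪S.actn p, S.decomp Complex.I q⟫_ℂ - ⟪S.decomp Complex.I p, S.actn q⟫_ℂ =
      ⟪p.2, S.τ q.1⟫_ℂ - ⟪S.τ p.1, q.2⟫_ℂ := by
  have pair : ∀ (ψ : HPlus S.A) (Q : 𝔥), ⟪op S.A ψ, S.Gstar Complex.I Q⟫_ℂ -
      ⟪incl S.A ψ, Complex.I • S.Gdiamond Complex.I Q⟫_ℂ = -⟪S.τ ψ, Q⟫_ℂ := by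
    intro ψ Q
    have h := congrArg (fun F : HMinus S.A => F ψ) (S.opBar_decomp (0, Q))
    simp only [decomp_apply, actn, map_zero, zero_add] at h
    change ⟪op S.A ψ, S.Gstar Complex.I Q⟫_ℂ =
      ⟪incl S.A ψ, Complex.I • S.Gdiamond Complex.I Q⟫_ℂ - ⟪S.τ ψ, Q⟫_ℂ at h
    rw [h]
    ring
  have h1 := pair p.1 q.2
  have h2 := congrArg (starRingEnd ℂ) (pair q.1 p.2)
  simp only [map_sub, map_neg, inner_conj_symm] at h2
  -- Up to a constant this is `⟨G₊ ·, G₊ ·⟩ - ⟨G₋ ·, G₋ ·⟩`, which vanishes as `G_±` induce the same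
  -- form.
  have h3 : ⟪Complex.I • S.Gdiamond Complex.I p.2, S.Gstar Complex.I q.2⟫_ℂ -
      ⟪S.Gstar Complex.I p.2, Complex.I • S.Gdiamond Complex.I q.2⟫_ℂ = 0 := by
    simp only [Gstar_I, Gdiamond_I, inner_smul_left, inner_smul_right, inner_add_left,
      inner_add_right, inner_sub_left, inner_sub_right, inner_Gminus_eq_Gplus, Complex.conj_I]
    ring
  simp only [decomp_apply, actn, inner_add_left, inner_add_right,
    inner_op_comm S.A S.isSelfAdjoint]
  linear_combination h1 - h2 + h3

lemma isSelfAdjoint_ATheta (hΘ : IsSelfAdjoint Θ) : IsSelfAdjoint (S.ATheta I_im_ne Θ) := by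
  have hN : ∀ ψ : HPlus S.A, S.τ ψ = 0 →
      (incl S.A ψ, op S.A ψ) ∈ (S.ATheta I_im_ne Θ).graph := fun ψ hψ =>
    (S.mem_graph_ATheta_iff Θ _ _).mpr
      ⟨(ψ, 0), by rw [hψ]; exact Θ.graph.zero_mem, by simp [decomp_apply], by simp [actn]⟩
  have hdense : Dense ((S.ATheta I_im_ne Θ).domain : Set H) := by
    refine S.dense_ker_τ.mono ?_
    rintro _ ⟨ψ, hψ, rfl⟩
    exact LinearPMap.mem_domain_of_mem_graph (hN ψ hψ)
  refine LinearPMap.isSelfAdjoint_of_mem_graph_iff hdense fun x y => ?_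
  constructor
  · intro h
    -- `A_Θ` extends `A_𝒩`, so its adjoint is contained in `A_𝒩^*` and Green's formula applies to
    -- `(x, y)`.
    have hx : (x, y) ∈ S.AN.adjoint.graph := by
      rw [mem_graph_AN_adjoint_iff_ker]
      exact fun ψ hψ => h _ _ (hN ψ hψ)
    obtain ⟨q, rfl, rfl⟩ := (S.mem_graph_AN_adjoint_iff _ _).mp hx
    refine (S.mem_graph_ATheta_iff Θ _ _).mpr ⟨q, ?_, rfl, rfl⟩
    rw [LinearPMap.mem_graph_iff_of_isSelfAdjoint hΘ]
    intro a b hab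
    -- Every pair in the graph of `Θ` is the boundary data of a vector in `D(A_Θ)`, so the boundary
    -- data of `x` is tested against all of `Θ`.
    obtain ⟨ψ, rfl⟩ := S.surjective_τ b
    have h1 := h _ _ ((S.mem_graph_ATheta_iff Θ _ _).mpr ⟨(ψ, a), hab, rfl, rfl⟩)
    have h2 := S.inner_actn_sub_inner_actn (ψ, a) q
    rw [h1, sub_self] at h2
    exact (sub_eq_zero.mp h2.symm).symm
  · intro h a b hab
    obtain ⟨q, hq, rfl, rfl⟩ := (S.mem_graph_ATheta_iff Θ _ _).mp h
    obtain ⟨p, hp, rfl, rfl⟩ := (S.mem_graph_ATheta_iff Θ _ _).mp hab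
    have h1 := (LinearPMap.mem_graph_iff_of_isSelfAdjoint hΘ _ _).mp hq _ _ hp
    rw [← sub_eq_zero, inner_actn_sub_inner_actn, h1, sub_self]

end Theta

end ExtensionData

end SingularExt

theorem theorem4p1 {H 𝔥 : Type*}
    [NormedAddCommGroup H] [InnerProductSpace ℂ H] [CompleteSpace H]
    [NormedAddCommGroup 𝔥] [InnerProductSpace ℂ 𝔥] [CompleteSpace 𝔥]
    (S : SingularExt.ExtensionData H 𝔥) :
    -- `Ã = A_𝒩^*`, in particular `Ã` takes its values in `H`
    S.Atilde SingularExt.ExtensionData.I_im_ne = (SingularExt.iMinus S.A).toLinearMap.compPMap S.AN.adjoint ∧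
    -- `G_±` are bijections of `𝔥` onto `𝒦_±`
    Set.BijOn S.Gplus Set.univ (S.Kplus : Set H) ∧
    Set.BijOn S.Gminus Set.univ (S.Kminus : Set H) ∧
    -- they are unitary for `⟨√(-iΓ) Q₁, √(-iΓ) Q₂⟩`, where `-iΓ ≥ 0`
    0 ≤ -(Complex.I • S.GamI) ∧
    (∀ Q₁ Q₂ : 𝔥, ⟪S.Gplus Q₁, S.Gplus Q₂⟫_ℂ =
      ⟪CFC.sqrt (-(Complex.I • S.GamI)) Q₁, CFC.sqrt (-(Complex.I • S.GamI)) Q₂⟫_ℂ) ∧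
    (∀ Q₁ Q₂ : 𝔥, ⟪S.Gminus Q₁, S.Gminus Q₂⟫_ℂ =
      ⟪CFC.sqrt (-(Complex.I • S.GamI)) Q₁, CFC.sqrt (-(Complex.I • S.GamI)) Q₂⟫_ℂ) ∧
    ∀ Θ : 𝔥 →ₗ.[ℂ] 𝔥, IsSelfAdjoint Θ →
      -- `(Θ - Γ)⁻¹` exists as a bounded operator
      (S.thetaSubGam Θ).IsInvertible ∧
      -- `U` is unitary from `𝒦₊` onto `𝒦₋`, and `A_U = A_Θ`
      ∃ U : S.Kplus ≃ₗᵢ[ℂ] S.Kminus,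
        (∀ φ : S.Kplus, (U φ : H) = S.Umap Θ φ) ∧
        IsSelfAdjoint (S.ATheta SingularExt.ExtensionData.I_im_ne Θ) ∧
        SingularExt.vonNeumann S.AN U = S.ATheta SingularExt.ExtensionData.I_im_ne Θ ∧
        (SingularExt.iMinus S.A).toLinearMap.compPMap (SingularExt.vonNeumann S.AN U) =
          S.AThetaAdditive SingularExt.ExtensionData.I_im_ne Θ := by

  refine ⟨S.Atilde_eq, S.bijOn_G SingularExt.ExtensionData.I_im_ne, S.bijOn_Gminus,
    S.neg_I_smul_GamI_nonneg, S.inner_Gplus_eq_sqrt,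
    fun Q₁ Q₂ => (S.inner_Gminus_eq_Gplus Q₁ Q₂).trans (S.inner_Gplus_eq_sqrt Q₁ Q₂),
    fun Θ hΘ => ⟨S.isInvertible_thetaSubGam hΘ, S.Uiso hΘ, S.coe_Uiso hΘ,
      S.isSelfAdjoint_ATheta hΘ, S.vonNeumann_eq hΘ, ?_⟩⟩
  -- Both sides are the restriction of `Ã = I₋ A_𝒩^*` to `D(A_Θ)`.
  rw [S.vonNeumann_eq hΘ, S.ATheta_eq_domRestrict, LinearPMap.compPMap_domRestrict,
    SingularExt.ExtensionData.AThetaAdditive, S.Atilde_eq]
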